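/- All graphs are finite and simple. For even $n\ge 8$ put $q=n/2$ and let $A_n$ be the graph obtained from a cycle $v_1v_2\ldots v_qv_1$ by adding new vertices $u_1,\ldots,u_q$ and the edges $u_iv_i$ and $u_iv_{i+1}$ for $i=1,\ldots,q$, where $v_{q+1}=v_1$. For odd $n\ge 9$, let $F_n$ be obtained from $A_{n-1}$ by adding a vertex $x$ and the edges $xv_1$, $xv_2$; let $G_n$ be obtained from $A_{n-1}$ by adding a vertex $y$ and the edges $yu_1$, $yv_1$; and let $H_n$ be obtained from $A_{n-1}$ by subdividing the edge $v_1v_2$ with a new vertex $z$ and then adding the edge $zu_1$. Let $G$ be a graph of order $n\ge 6$. (1) If $G$ is $2$-connected and every edge of $G$ lies in a triangle, then $G$ has at least $\lceil 3n/2\rceil$ edges. (2) If $n\ge 8$ is even, then $G$ is $2$-connected, has every edge in a triangle and has exactly $\lceil 3n/2\rceil$ edges if and only if $G$ is isomorphic to $A_n$. (3) If $n\ge 9$ is odd, then $G$ is $2$-connected, has every edge in a triangle and has exactly $\lceil 3n/2\rceil$ edges if and only if $G$ is isomorphic to $F_n$, $G_n$ or $H_n$. -/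

import Mathlib

namespace TriangleRing

/-- A graph is 2-connected if it has at least three vertices, is connected, and stays connected
after the deletion of any one vertex. -/
def IsTwoConnected {V : Type*} [Fintype V] (G : SimpleGraph V) : Prop :=
  3 ≤ Fintype.card V ∧ G.Connected ∧ ∀ x : V, (G.induce {x}ᶜ).Connected

/-- Every edge of `G` lies in a triangle of `G`. -/
def EveryEdgeInTriangle {V : Type*} (G : SimpleGraph V) : Prop :=
  ∀ a b : V, G.Adj a b → ∃ c : V, G.Adj a c ∧ G.Adj b c

/-- The vertex `v_i` of `A_n`; the index is read modulo `q = n / 2`. -/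
def v {n : ℕ} (i : ZMod (n / 2)) : ZMod (n / 2) ⊕ ZMod (n / 2) := Sum.inl i

/-- The vertex `u_i` of `A_n`; the index is read modulo `q = n / 2`. -/
def u {n : ℕ} (i : ZMod (n / 2)) : ZMod (n / 2) ⊕ ZMod (n / 2) := Sum.inr i

/-- The graph `A_n` (meant for even `n ≥ 8`), with `q = n / 2`: the cycle `v_1 v_2 … v_q v_1`
together with the vertices `u_i` and the edges `u_i v_i` and `u_i v_{i+1}`. -/
def graphA (n : ℕ) : SimpleGraph (ZMod (n / 2) ⊕ ZMod (n / 2)) :=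
  SimpleGraph.fromEdgeSet
    {e | ∃ i : ZMod (n / 2),
      e = s(v (n := n) i, v (n := n) (i + 1)) ∨
      e = s(u (n := n) i, v (n := n) i) ∨
      e = s(u (n := n) i, v (n := n) (i + 1))}

/-- The graph obtained from `G` by adding one new vertex `none`, joined to exactly the vertices
in `S`. -/
def addVertex {V : Type*} (G : SimpleGraph V) (S : Set V) : SimpleGraph (Option V) where
  Adj
    | some a, some b => G.Adj a b
    | none, some b => b ∈ S
    | some a, none => a ∈ S
    | none, none => False
  symm := ⟨by rintro (_ | a) (_ | b) h <;> first | exact h | exact h.symm⟩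
  loopless := ⟨by rintro (_ | a) h <;> first | exact h | exact G.irrefl h⟩

/-- The graph `F_n` (meant for odd `n ≥ 9`): add to `A_{n-1}` a vertex `x` and the edges `x v_1`
and `x v_2`. -/
def graphF (n : ℕ) : SimpleGraph (Option (ZMod ((n - 1) / 2) ⊕ ZMod ((n - 1) / 2))) :=
  addVertex (graphA (n - 1)) {v (n := n - 1) 1, v (n := n - 1) 2}

/-- The graph `G_n` (meant for odd `n ≥ 9`): add to `A_{n-1}` a vertex `y` and the edges `y u_1`
and `y v_1`. -/
def graphG (n : ℕ) : SimpleGraph (Option (ZMod ((n - 1) / 2) ⊕ ZMod ((n - 1) / 2))) :=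
  addVertex (graphA (n - 1)) {u (n := n - 1) 1, v (n := n - 1) 1}

/-- The graph `H_n` (meant for odd `n ≥ 9`): subdivide the edge `v_1 v_2` of `A_{n-1}` by a vertex
`z`, that is, delete it and join a new vertex `z` to `v_1` and `v_2`; then add the edge `z u_1`. -/
def graphH (n : ℕ) : SimpleGraph (Option (ZMod ((n - 1) / 2) ⊕ ZMod ((n - 1) / 2))) :=
  addVertex ((graphA (n - 1)).deleteEdges {s(v (n := n - 1) 1, v (n := n - 1) 2)})
    {v (n := n - 1) 1, v (n := n - 1) 2, u (n := n - 1) 1}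

end TriangleRing

/-! Two edges are equivalent if a chain of triangles leads from one to the other; the classes are
the blocks. Growing a class from one edge by adding triangles costs two edges for each new vertex,
so a block with c vertices has e ≥ 2c - 3 edges (`two_mul_ncard_cover_block_le`). Let s be the
number of its vertices that lie in other blocks as well, and μ(x) the number of blocks through x.
For a graph with n vertices and m edges, double counting (`sum_excess`) gives 4m - 6n = Σ_blocks (4e
- 6c + 3s) + Σ_{μ(x) ≥ 2} (3μ(x) - 6).

If there are several blocks, 2-connectedness forces s ≥ 2 (`two_le_card_shared`), so each block term
is at least 2c - 6 ≥ 0 and m ≥ 3n/2. A single block gives m ≥ 2n - 3, which suffices for n ≥ 6.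

If n ≥ 8 and m = ⌈3n/2⌉, the right side is 0 or 2. Then μ ≤ 2, s = 2 and e = 2c - 3 throughout
(`extremal`), so the blocks form a ring (`exists_ring_numbering`). For even n all blocks are
triangles and the graph is A_n. For odd n exactly one block has four vertices and five edges, so it
is a K_4 without one edge. The missing pair contains none, one or both of the two shared vertices of
that block, and this yields F_n, G_n or H_n. -/

namespace TriangleRing

/-! ### 2-connectedness in terms of closed vertex sets. -/

/-- Every vertex set avoiding `x` which is closed under adjacency in `G - x` and nonempty consists
of all vertices other than `x`. -/
def NoCut {V : Type*} (G : SimpleGraph V) : Prop :=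
  ∀ (x : V) (S : Set V), S.Nonempty → x ∉ S →
    (∀ a ∈ S, ∀ b, G.Adj a b → b ≠ x → b ∈ S) → ∀ y, y ≠ x → y ∈ S

theorem connected_iff_closed {V : Type*} (G : SimpleGraph V) :
    G.Connected ↔ Nonempty V ∧ ∀ S : Set V, S.Nonempty →
      (∀ a ∈ S, ∀ b, G.Adj a b → b ∈ S) → ∀ y, y ∈ S := by
  constructor
  · intro h
    refine ⟨h.nonempty, ?_⟩
    rintro S ⟨a, ha⟩ hS y
    obtain ⟨p⟩ := h.preconnected a y
    induction p with
    | nil => exact ha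
    | cons hadj _ ih => exact ih (hS _ ha _ hadj)
  · rintro ⟨hne, h⟩
    refine SimpleGraph.Connected.mk ?_
    intro a b
    exact h {y | G.Reachable a y} ⟨a, SimpleGraph.Reachable.refl a⟩
      (fun c hc d hd => SimpleGraph.Reachable.trans hc hd.reachable) b

/-- Connectedness of `G` itself need not be checked separately: s and y are joined already after the
deletion of a third vertex. -/
theorem isTwoConnected_iff_noCut {V : Type*} [Fintype V] (G : SimpleGraph V) :
    IsTwoConnected G ↔ 3 ≤ Fintype.card V ∧ NoCut G := by
  constructor
  · rintro ⟨hc, -, h⟩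
    refine ⟨hc, ?_⟩
    rintro x S ⟨s, hs⟩ hx hS y hy
    have := ((connected_iff_closed _).1 (h x)).2 {z | z.1 ∈ S}
      ⟨⟨s, fun hsx => hx (hsx ▸ hs)⟩, hs⟩
      (fun a ha b hb => hS _ ha _ hb b.2) ⟨y, hy⟩
    exact this
  · rintro ⟨hc, h⟩
    refine ⟨hc, ?_, ?_⟩
    · rw [connected_iff_closed]
      refine ⟨Fintype.card_pos_iff.1 (by omega), ?_⟩
      rintro S ⟨s, hs⟩ hS y
      obtain ⟨x, hx⟩ : ∃ x, x ≠ s ∧ x ≠ y := by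
        classical
        by_contra! hcon
        have h1 : Fintype.card V ≤ ({s, y} : Finset V).card := by
          rw [← Finset.card_univ]
          refine Finset.card_le_card fun z _ => ?_
          simpa [or_iff_not_imp_left] using hcon z
        have := Finset.card_le_two (a := s) (b := y)
        omega
      exact (h x (S \ {x}) ⟨s, hs, fun e => hx.1 e.symm⟩ (fun e => e.2 rfl)
        (fun a ha b hab hb => ⟨hS a ha.1 b hab, hb⟩) y (fun e => hx.2 e.symm)).1
    · intro x
      rw [connected_iff_closed]
      constructor
      · obtain ⟨y, hy⟩ := Fintype.exists_ne_of_one_lt_card (by omega) x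
        exact ⟨⟨y, hy⟩⟩
      · rintro S ⟨s, hs⟩ hS y
        have := h x (Subtype.val '' S) ⟨s, s, hs, rfl⟩ (by rintro ⟨z, -, hz⟩; exact z.2 hz)
          (by
            rintro _ ⟨a, ha, rfl⟩ b hab hb
            exact ⟨⟨b, hb⟩, hS a ha ⟨b, hb⟩ hab, rfl⟩) y y.2
        obtain ⟨z, hz, hzy⟩ := this
        rwa [Subtype.ext hzy] at hz

theorem NoCut.of_iso {V W : Type*} {G : SimpleGraph V} {H : SimpleGraph W} (e : G ≃g H)
    (h : NoCut H) : NoCut G := by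
  rintro x S ⟨s, hs⟩ hx hS y hy
  have := h (e x) (e '' S) ⟨e s, s, hs, rfl⟩ (by rintro ⟨z, hz, hzx⟩; exact hx (e.injective hzx ▸ hz))
    (by
      rintro _ ⟨a, ha, rfl⟩ b hab hb
      obtain ⟨b, rfl⟩ := e.surjective b
      exact ⟨b, hS a ha b (e.map_adj_iff.1 hab) (fun h => hb (h ▸ rfl)), rfl⟩) (e y)
    (fun h => hy (e.injective h))
  obtain ⟨z, hz, hzy⟩ := this
  exact e.injective hzy ▸ hz

theorem NoCut.mono {V : Type*} {G H : SimpleGraph V} (hGH : G ≤ H) (h : NoCut G) : NoCut H :=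
  fun x S hne hx hS => h x S hne hx fun a ha b hab => hS a ha b (hGH hab)

theorem EveryEdgeInTriangle.of_iso {V W : Type*} {G : SimpleGraph V} {H : SimpleGraph W}
    (e : G ≃g H) (h : EveryEdgeInTriangle H) : EveryEdgeInTriangle G := by
  intro a b hab
  obtain ⟨c, h1, h2⟩ := h (e a) (e b) (e.map_adj_iff.2 hab)
  obtain ⟨c, rfl⟩ := e.surjective c
  exact ⟨c, e.map_adj_iff.1 h1, e.map_adj_iff.1 h2⟩

/-- A graph with a Hamiltonian cycle, given as a periodic sequence, has no cut vertex. -/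
theorem NoCut.of_periodic {V : Type*} {G : SimpleGraph V} {N : ℕ} (g : ℕ → V)
    (hadj : ∀ k, G.Adj (g k) (g (k + 1))) (hinj : ∀ k l, g k = g l ↔ k ≡ l [MOD N])
    (hsurj : Function.Surjective g) (hN : 0 < N) : NoCut G := by
  rintro x S ⟨s, hs⟩ hx hS y hy
  obtain ⟨i, rfl⟩ := hsurj x
  -- In ℕ the number j + i(N - 1) stands for j - i modulo N.
  have key : ∀ z, z ≠ g i → ∃ a, 0 < a ∧ a < N ∧ z = g (i + a) := by
    intro z hz
    obtain ⟨j, rfl⟩ := hsurj z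
    have hmod : i + (j + i * (N - 1)) % N ≡ j [MOD N] := by
      have : i + (j + i * (N - 1)) = j + N * i := by
        obtain ⟨M, rfl⟩ : ∃ M, N = M + 1 := ⟨N - 1, by omega⟩
        simp; ring
      calc i + (j + i * (N - 1)) % N ≡ i + (j + i * (N - 1)) [MOD N] :=
            Nat.ModEq.add_left _ (Nat.mod_modEq _ _)
        _ = j + N * i := this
        _ ≡ j [MOD N] := by simp [Nat.ModEq]
    refine ⟨(j + i * (N - 1)) % N, ?_, Nat.mod_lt _ hN, ((hinj _ _).2 hmod).symm⟩
    rcases Nat.eq_zero_or_pos ((j + i * (N - 1)) % N) with h0 | h0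
    · rw [h0] at hmod
      exact absurd ((hinj _ _).2 hmod).symm (by simpa using hz)
    · exact h0
  have hne : ∀ a, 0 < a → a < N → g (i + a) ≠ g i := by
    intro a ha haN h
    have h2 : i + a ≡ i + 0 [MOD N] := (hinj _ _).1 h
    have h3 := Nat.ModEq.add_left_cancel' i h2
    rw [Nat.ModEq, Nat.mod_eq_of_lt haN, Nat.zero_mod] at h3
    omega
  -- Deleting g i leaves the path g (i + 1), ..., g (i + N - 1): descend from the given element of S
  -- to its first vertex, then climb to y.
  have down : ∀ a, 0 < a → a < N → g (i + a) ∈ S → g (i + 1) ∈ S := by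
    intro a
    induction a with
    | zero => omega
    | succ a ih =>
      intro _ haN hm
      rcases Nat.eq_zero_or_pos a with rfl | ha
      · exact hm
      · exact ih ha (by omega) (hS _ hm _ (hadj (i + a)).symm (hne a ha (by omega)))
  have up : ∀ a, a + 1 < N → g (i + 1) ∈ S → g (i + (a + 1)) ∈ S := by
    intro a
    induction a with
    | zero => exact fun _ h => h
    | succ a ih =>
      intro haN h
      exact hS _ (ih (by omega) h) _ (hadj (i + (a + 1))) (hne _ (by omega) haN)
  obtain ⟨a, ha, haN, rfl⟩ := key s (fun h => hx (h ▸ hs))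
  obtain ⟨b, hb, hbN, rfl⟩ := key y hy
  obtain ⟨b, rfl⟩ : ∃ b', b = b' + 1 := ⟨b - 1, by omega⟩
  exact up b hbN (down a ha haN hs)

/-- Deleting an old vertex leaves the new one at least one of its neighbours s, t. Deleting the new
vertex leaves `G`, whose connectedness follows by avoiding a third vertex z. -/
theorem NoCut.addVertex {V : Type*} {G : SimpleGraph V} (h : NoCut G) {T : Set V} {s t : V}
    (hs : s ∈ T) (ht : t ∈ T) (hst : s ≠ t) (hV : ∀ a b : V, ∃ x, x ≠ a ∧ x ≠ b) :
    NoCut (addVertex G T) := by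
  rintro (_ | x) S hne hx hS (_ | y) hy
  · exact absurd rfl hy
  · obtain ⟨_ | a, ha⟩ := hne
    · exact absurd ha hx
    · obtain ⟨z, hza, hzy⟩ := hV a y
      have := h z {v | some v ∈ S ∧ v ≠ z} ⟨a, ha, hza.symm⟩ (fun e => e.2 rfl)
        (fun a ha b hab hb => ⟨hS (some a) ha.1 (some b) hab (by simp), hb⟩) y hzy.symm
      exact this.1
  all_goals
    have hsome : ∃ a, some a ∈ S := by
      obtain ⟨_ | a, ha⟩ := hne
      · by_cases hsx : s = x
        · exact ⟨t, hS none ha (some t) ht (by simpa using fun e => hst (hsx.trans e.symm))⟩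
        · exact ⟨s, hS none ha (some s) hs (by simpa using hsx)⟩
      · exact ⟨a, ha⟩
    obtain ⟨a, ha⟩ := hsome
    have hall := h x {v | some v ∈ S} ⟨a, ha⟩ hx
      (fun a ha b hab hb => hS (some a) ha (some b) hab (by simpa using hb))
  · by_cases hsx : s = x
    · exact hS (some t) (hall t fun e => hst (hsx.trans e.symm)) none ht (by simp)
    · exact hS (some s) (hall s hsx) none hs (by simp)
  · exact hall y (by simpa using hy)

/-! ### The graph A_n: triangles, 2-connectedness and number of edges. -/

/-- The vertex set of the `i`-th triangle of `A_n`. -/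
def cell {q : ℕ} (i : ZMod q) : Set (ZMod q ⊕ ZMod q) := {Sum.inl i, Sum.inl (i + 1), Sum.inr i}

theorem zmod_add_one_ne {q : ℕ} (hq : 2 ≤ q) (i : ZMod q) : i + 1 ≠ i := by
  have : Fact (1 < q) := ⟨hq⟩
  simp

theorem zmod_two_ne_zero {q : ℕ} (hq : 3 ≤ q) : (1 + 1 : ZMod q) ≠ 0 := by
  intro h
  have h2 : ((2 : ℕ) : ZMod q) = 0 := by push_cast; rw [← h]; ring
  rw [ZMod.natCast_eq_zero_iff] at h2
  have := Nat.le_of_dvd (by norm_num) h2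
  omega

/-- This is the form in which a block decomposition describes adjacency, so an isomorphism only has
to match blocks with cells. -/
theorem graphA_adj {n : ℕ} (hn : 2 ≤ n / 2) (a b : ZMod (n / 2) ⊕ ZMod (n / 2)) :
    (graphA n).Adj a b ↔ a ≠ b ∧ ∃ i, a ∈ cell i ∧ b ∈ cell i := by
  have h1 := zmod_add_one_ne hn
  rw [graphA, SimpleGraph.fromEdgeSet_adj, and_comm]
  refine and_congr_right fun hab => exists_congr fun i => ?_
  simp only [u, v, cell, Sym2.eq_iff, Set.mem_insert_iff, Set.mem_singleton_iff]
  constructor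
  · rintro ((⟨rfl, rfl⟩ | ⟨rfl, rfl⟩) | (⟨rfl, rfl⟩ | ⟨rfl, rfl⟩) | (⟨rfl, rfl⟩ | ⟨rfl, rfl⟩)) <;> simp
  · rintro ⟨rfl | rfl | rfl, rfl | rfl | rfl⟩ <;> simp at hab ⊢

theorem everyEdgeInTriangle_graphA {n : ℕ} (hn : 2 ≤ n / 2) : EveryEdgeInTriangle (graphA n) := by
  have h1 := zmod_add_one_ne hn
  intro a b hab
  obtain ⟨hne, i, ha, hb⟩ := (graphA_adj hn a b).1 hab
  obtain ⟨c, hc, hca, hcb⟩ : ∃ c ∈ cell i, a ≠ c ∧ b ≠ c := by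
    have h2 := (h1 i).symm
    simp only [cell, Set.mem_insert_iff, Set.mem_singleton_iff] at ha hb ⊢
    rcases ha with rfl | rfl | rfl <;> rcases hb with rfl | rfl | rfl <;>
      simp [h1 i, h2] at hne ⊢
  exact ⟨c, (graphA_adj hn a c).2 ⟨hca, i, ha, hc⟩, (graphA_adj hn b c).2 ⟨hcb, i, hb, hc⟩⟩

/-- The Hamiltonian cycle v_0 u_0 v_1 u_1 ... uses no edge v_i v_{i+1}, so it survives the deletion.
The version with a deleted edge is what H_n requires. -/
theorem noCut_graphA_deleteEdges {n : ℕ} (hn : 2 ≤ n / 2) (j : ZMod (n / 2)) :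
    NoCut ((graphA n).deleteEdges {s(v (n := n) j, v (n := n) (j + 1))}) := by
  set q := n / 2 with hq
  have h1 := zmod_add_one_ne hn
  have : NeZero q := ⟨by omega⟩
  let g : ℕ → ZMod q ⊕ ZMod q := fun k =>
    if k % 2 = 0 then Sum.inl ((k / 2 : ℕ) : ZMod q) else Sum.inr ((k / 2 : ℕ) : ZMod q)
  refine NoCut.of_periodic (N := 2 * q) g ?_ ?_ ?_ (by omega)
  · intro k
    rw [SimpleGraph.deleteEdges_adj, graphA_adj hn]
    rcases Nat.even_or_odd' k with ⟨m, rfl | rfl⟩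
    · have h3 : (2 * m + 1) / 2 = m := by omega
      have h4 : (2 * m + 1) % 2 = 1 := by omega
      simp only [g, h3, h4]
      refine ⟨⟨by simp, m, by simp [cell], by simp [cell]⟩, by simp [v]⟩
    · have h3 : (2 * m + 1) / 2 = m := by omega
      have h4 : (2 * m + 1) % 2 = 1 := by omega
      have h5 : (2 * m + 1 + 1) / 2 = m + 1 := by omega
      have h6 : (2 * m + 1 + 1) % 2 = 0 := by omega
      simp only [g, h3, h4, h5, h6]
      refine ⟨⟨by simp, m, by simp [cell], by simp [cell]⟩, by simp [v]⟩
  · intro k l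
    have hkl : k ≡ l [MOD 2 * q] ↔ k % 2 = l % 2 ∧ k / 2 ≡ l / 2 [MOD q] := by
      rw [Nat.ModEq, Nat.ModEq, Nat.mod_mul, Nat.mod_mul]
      omega
    rw [hkl, ← ZMod.natCast_eq_natCast_iff]
    simp only [g]
    rcases Nat.mod_two_eq_zero_or_one k with hk | hk <;>
      rcases Nat.mod_two_eq_zero_or_one l with hl | hl <;> simp [hk, hl]
  · rintro (i | i)
    · refine ⟨2 * i.val, ?_⟩
      simp [g]
    · refine ⟨2 * i.val + 1, ?_⟩
      have h3 : (2 * i.val + 1) / 2 = i.val := by omega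
      have h4 : (2 * i.val + 1) % 2 = 1 := by omega
      simp [g, h3, h4]

theorem noCut_graphA {n : ℕ} (hn : 2 ≤ n / 2) : NoCut (graphA n) :=
  (noCut_graphA_deleteEdges hn 1).mono (SimpleGraph.deleteEdges_le _)

theorem ncard_edgeSet_graphA {n : ℕ} (hn : 3 ≤ n / 2) :
    (graphA n).edgeSet.ncard = 3 * (n / 2) := by
  have h1 := zmod_add_one_ne (q := n / 2) (by omega)
  have h2 := zmod_two_ne_zero hn
  have : NeZero (n / 2) := ⟨by omega⟩
  let f : ZMod (n / 2) ⊕ ZMod (n / 2) ⊕ ZMod (n / 2) → Sym2 (ZMod (n / 2) ⊕ ZMod (n / 2)) :=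
    Sum.elim (fun i => s(Sum.inl i, Sum.inl (i + 1)))
      (Sum.elim (fun i => s(Sum.inr i, Sum.inl i)) (fun i => s(Sum.inr i, Sum.inl (i + 1))))
  have hf : Function.Injective f := by
    rintro (i | i | i) (j | j | j) h <;> simp [f] at h ⊢
    · rcases h with h | ⟨rfl, h⟩
      · exact h
      -- Two cycle edges matched crosswise would give i = i + 2, impossible for q ≥ 3.
      · refine absurd ?_ h2
        rw [add_assoc] at h
        simpa using h
    · exact h
    · obtain ⟨rfl, h⟩ := h
      exact absurd h.symm (h1 _)
    · obtain ⟨rfl, h⟩ := h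
      exact absurd h (h1 _)
    · exact h
  have hr : (graphA n).edgeSet = Set.range f := by
    ext e
    simp only [graphA, SimpleGraph.edgeSet_fromEdgeSet, Set.mem_sdiff, Set.mem_ofPred_eq,
      Set.mem_range, Sum.exists, f, Sum.elim_inl, Sum.elim_inr, u, v]
    constructor
    · rintro ⟨⟨i, rfl | rfl | rfl⟩, -⟩
      · exact Or.inl ⟨i, rfl⟩
      · exact Or.inr (Or.inl ⟨i, rfl⟩)
      · exact Or.inr (Or.inr ⟨i, rfl⟩)
    · rintro (⟨i, rfl⟩ | ⟨i, rfl⟩ | ⟨i, rfl⟩)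
      · exact ⟨⟨i, Or.inl rfl⟩, by simpa using (h1 i).symm⟩
      · exact ⟨⟨i, Or.inr (Or.inl rfl)⟩, by simp⟩
      · exact ⟨⟨i, Or.inr (Or.inr rfl)⟩, by simp⟩
  rw [hr, ← Set.image_univ, Set.ncard_image_of_injective _ hf, Set.ncard_univ]
  simp
  ring

theorem ncard_edgeSet_addVertex {V : Type*} [Finite V] (G : SimpleGraph V) (T : Set V) :
    (addVertex G T).edgeSet.ncard = G.edgeSet.ncard + T.ncard := by
  have h : (addVertex G T).edgeSet =
      Sym2.map some '' G.edgeSet ∪ (fun x => s(none, some x)) '' T := by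
    ext e
    induction e using Sym2.ind with
    | _ a b =>
      rw [SimpleGraph.mem_edgeSet]
      constructor
      · rcases a with _ | a <;> rcases b with _ | b <;> intro h
        · exact h.elim
        · exact Or.inr ⟨b, h, rfl⟩
        · exact Or.inr ⟨a, h, Sym2.eq_swap⟩
        · exact Or.inl ⟨s(a, b), h, rfl⟩
      · rintro (⟨e, he, hab⟩ | ⟨x, hx, hab⟩)
        · induction e using Sym2.ind with
          | _ c d =>
            rw [Sym2.map_mk, Sym2.eq_iff] at hab
            rcases hab with ⟨rfl, rfl⟩ | ⟨rfl, rfl⟩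
            · exact he
            · exact G.adj_symm he
        · rw [Sym2.eq_iff] at hab
          rcases hab with ⟨rfl, rfl⟩ | ⟨rfl, rfl⟩ <;> exact hx
  rw [h, Set.ncard_union_eq, Set.ncard_image_of_injective _ (Sym2.map.injective (Option.some_injective V)),
    Set.ncard_image_of_injective]
  · intro x y hxy
    simpa using hxy
  · rw [Set.disjoint_left]
    rintro _ ⟨e, -, rfl⟩ ⟨x, -, hx⟩
    have : none ∈ Sym2.map some e := hx ▸ Sym2.mem_mk_left _ _
    simp at this

-- Triangle-connected classes of edges.

universe w

/-- The relation between two pairs that are two sides of a common triangle of `G`. -/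
def TriangleStep {V : Type w} (G : SimpleGraph V) (e f : Sym2 V) : Prop :=
  ∃ a b c, e = s(a, b) ∧ f = s(a, c) ∧ G.Adj a b ∧ G.Adj a c ∧ G.Adj b c

/-- Triangle-connectedness of pairs of vertices. -/
def triangleSetoid {V : Type w} (G : SimpleGraph V) : Setoid (Sym2 V) :=
  Relation.EqvGen.setoid (TriangleStep G)

/-- The graph formed by the edges of `G` in one class of triangle-connectedness. -/
def block {V : Type w} (G : SimpleGraph V) (q : Quotient (triangleSetoid G)) : SimpleGraph V where
  Adj a b := G.Adj a b ∧ Quotient.mk _ s(a, b) = q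
  symm := ⟨fun a b h => ⟨h.1.symm, by rw [Sym2.eq_swap]; exact h.2⟩⟩
  loopless := ⟨fun a h => G.irrefl h.1⟩

theorem triangleStep_edge {V : Type w} {G : SimpleGraph V} {e f : Sym2 V}
    (h : TriangleStep G e f) : e ∈ G.edgeSet ∧ f ∈ G.edgeSet := by
  obtain ⟨a, b, c, rfl, rfl, h1, h2, h3⟩ := h
  exact ⟨h1, h2⟩

theorem mem_block_of_step {V : Type w} {G : SimpleGraph V} {q : Quotient (triangleSetoid G)}
    {e f : Sym2 V} (h : TriangleStep G e f) (he : e ∈ (block G q).edgeSet) :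
    f ∈ (block G q).edgeSet := by
  have hf := (triangleStep_edge h).2
  have hq : (Quotient.mk (triangleSetoid G) f) = Quotient.mk _ e :=
    Quotient.sound (Relation.EqvGen.symm _ _ (Relation.EqvGen.rel _ _ h))
  induction e using Sym2.ind with
  | _ a b =>
    induction f using Sym2.ind with
    | _ c d => exact ⟨hf, hq.trans he.2⟩

theorem TriangleStep.symm {V : Type w} {G : SimpleGraph V} {e f : Sym2 V}
    (h : TriangleStep G e f) : TriangleStep G f e := by
  obtain ⟨a, b, c, h1, h2, h3, h4, h5⟩ := h
  exact ⟨a, c, b, h2, h1, h4, h3, h5.symm⟩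

/-- A set of edges of a block that is closed under triangle steps contains every edge. -/
theorem block_closed {V : Type w} {G : SimpleGraph V} {q : Quotient (triangleSetoid G)}
    {S : Set (Sym2 V)} (hS : ∀ e ∈ S, ∀ f, TriangleStep G e f → f ∈ S) {e f : Sym2 V} (he : e ∈ S)
    (heq : e ∈ (block G q).edgeSet) (hf : f ∈ (block G q).edgeSet) : f ∈ S := by
  have h1 : Quotient.mk (triangleSetoid G) e = Quotient.mk _ f := by
    induction e using Sym2.ind with
    | _ a b =>
      induction f using Sym2.ind with
      | _ c d => exact heq.2.trans hf.2.symm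
  have h2 : Relation.EqvGen (TriangleStep G) e f := Quotient.exact h1
  have h3 : e ∈ S ↔ f ∈ S := by
    clear he heq hf h1
    induction h2 with
    | rel x y h => exact ⟨fun hx => hS x hx y h, fun hy => hS y hy x h.symm⟩
    | refl x => rfl
    | symm x y _ ih => exact ih.symm
    | trans x y z _ _ ih1 ih2 => exact ih1.trans ih2
  exact h3.1 he

/-- The vertices covered by a set of pairs. -/
def cover {V : Type w} (S : Set (Sym2 V)) : Set V := {x | ∃ e ∈ S, x ∈ e}

/-- A triangle-connected class of `e` edges on `c` vertices has `e ≥ 2 c - 3`. -/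
theorem two_mul_ncard_cover_block_le {V : Type w} [Finite V] {G : SimpleGraph V}
    (q : Quotient (triangleSetoid G)) (hne : (block G q).edgeSet.Nonempty) :
    2 * (cover (block G q).edgeSet).ncard ≤ (block G q).edgeSet.ncard + 3 := by
  obtain ⟨e₀, he₀⟩ := hne
  -- A maximal edge set satisfying the bound is shown to be the whole class. The constant 3 comes
  -- from the start: one edge covers two vertices, and 2 · 2 = 1 + 3.
  let P : Set (Sym2 V) → Prop := fun S =>
    S ⊆ (block G q).edgeSet ∧ e₀ ∈ S ∧ 2 * (cover S).ncard ≤ S.ncard + 3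
  have hP : P {e₀} := by
    refine ⟨by simpa using he₀, rfl, ?_⟩
    induction e₀ using Sym2.ind with
    | _ a b =>
      have : cover {s(a, b)} = {a, b} := by
        ext x
        simp [cover]
      rw [this, Set.ncard_singleton]
      have := Set.ncard_insert_le a {b}
      rw [Set.ncard_singleton] at this
      omega
  obtain ⟨S, hS⟩ := Set.Finite.exists_maximal (Set.toFinite {S | P S}) ⟨_, hP⟩
  obtain ⟨⟨hSB, hS0, hSc⟩, hmax⟩ := hS
  suffices S = (block G q).edgeSet by rwa [this] at hSc
  refine Set.Subset.antisymm hSB fun f hf => ?_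
  refine block_closed ?_ hS0 he₀ hf
  rintro e he f hstep
  -- If S contains ab but not ac, adding ac and bc keeps the bound: either c is new and comes with
  -- two new edges, or no vertex is gained.
  by_contra hfS
  obtain ⟨a, b, c, rfl, rfl, hab, hac, hbc⟩ := hstep
  have hst : TriangleStep G s(a, b) s(b, c) :=
    ⟨b, a, c, Sym2.eq_swap, rfl, hab.symm, hbc, hac⟩
  have hacB : s(a, c) ∈ (block G q).edgeSet :=
    mem_block_of_step ⟨a, b, c, rfl, rfl, hab, hac, hbc⟩ (hSB he)
  have hbcB : s(b, c) ∈ (block G q).edgeSet := mem_block_of_step hst (hSB he)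
  have hsub : insert s(a, c) (insert s(b, c) S) ⊆ (block G q).edgeSet :=
    Set.insert_subset hacB (Set.insert_subset hbcB hSB)
  have hcov : cover (insert s(a, c) (insert s(b, c) S)) = insert c (cover S) := by
    ext x
    simp only [cover, Set.mem_insert_iff, exists_eq_or_imp, Sym2.mem_iff, Set.mem_ofPred_eq]
    constructor
    · rintro ((rfl | rfl) | (rfl | rfl) | h)
      · exact Or.inr ⟨_, he, by simp⟩
      · exact Or.inl rfl
      · exact Or.inr ⟨_, he, by simp⟩
      · exact Or.inl rfl
      · exact Or.inr h
    · rintro (rfl | h)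
      · simp
      · exact Or.inr (Or.inr h)
  have hnew : P (insert s(a, c) (insert s(b, c) S)) := by
    refine ⟨hsub, by simp [hS0], ?_⟩
    rw [hcov]
    by_cases hc : c ∈ cover S
    · rw [Set.insert_eq_of_mem hc]
      have : S.ncard ≤ (insert s(a, c) (insert s(b, c) S)).ncard :=
        Set.ncard_le_ncard (fun x hx => by simp [hx]) (Set.toFinite _)
      omega
    · have h1 : s(b, c) ∉ S := fun h => hc ⟨_, h, by simp⟩
      have h2 : s(a, c) ∉ insert s(b, c) S := by
        rintro (h | h)
        · rw [Sym2.eq_iff] at h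
          rcases h with ⟨h, -⟩ | ⟨h, -⟩
          · exact hab.ne h
          · exact hac.ne h
        · exact hc ⟨_, h, by simp⟩
      rw [Set.ncard_insert_of_notMem hc, Set.ncard_insert_of_notMem h2,
        Set.ncard_insert_of_notMem h1]
      omega
  exact hfS (hmax hnew (fun x hx => by simp [hx]) (by simp))

/-! ### Block decompositions. -/

/-- The graphs `B i`, with vertex sets `S i`, partition the edges of `G`; each has `c ≥ 3` vertices
and at least `2 c - 3` edges. -/
structure IsBlockDecomposition {V : Type w} {ι : Type*} (G : SimpleGraph V) (B : ι → SimpleGraph V)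
    (S : ι → Finset V) : Prop where
  adj {i : ι} {a b : V} : (B i).Adj a b → G.Adj a b
  exists_adj {a b : V} : G.Adj a b → ∃ i, (B i).Adj a b
  unique {i j : ι} {a b : V} : (B i).Adj a b → (B j).Adj a b → i = j
  mem_iff {i : ι} {a : V} : a ∈ S i ↔ ∃ b, (B i).Adj a b
  two_mul_card_le (i : ι) : 2 * (S i).card ≤ (B i).edgeSet.ncard + 3
  three_le_card (i : ι) : 3 ≤ (S i).card

theorem IsBlockDecomposition.mem_left {V : Type w} {ι : Type*} {G : SimpleGraph V}
    {B : ι → SimpleGraph V} {S : ι → Finset V} (D : IsBlockDecomposition G B S) {i : ι} {a b : V}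
    (h : (B i).Adj a b) : a ∈ S i :=
  D.mem_iff.2 ⟨b, h⟩

theorem IsBlockDecomposition.mem_right {V : Type w} {ι : Type*} {G : SimpleGraph V}
    {B : ι → SimpleGraph V} {S : ι → Finset V} (D : IsBlockDecomposition G B S) {i : ι} {a b : V}
    (h : (B i).Adj a b) : b ∈ S i :=
  D.mem_left h.symm

theorem exists_isBlockDecomposition {V : Type w} [Fintype V] {G : SimpleGraph V}
    (htri : EveryEdgeInTriangle G) :
    ∃ (ι : Type w) (_ : Fintype ι) (B : ι → SimpleGraph V) (S : ι → Finset V),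
      IsBlockDecomposition G B S := by
  classical
  -- Pairs that are not edges form classes too; only classes containing an edge are kept.
  refine ⟨{q // (block G q).edgeSet.Nonempty}, Fintype.ofFinite _, fun q => block G q.1,
    fun q => (cover (block G q.1).edgeSet).toFinset, fun h => h.1, ?_, ?_, ?_, ?_, ?_⟩
  · intro a b hab
    exact ⟨⟨Quotient.mk _ s(a, b), s(a, b), hab, rfl⟩, hab, rfl⟩
  · intro i j a b hi hj
    exact Subtype.ext (hi.2.symm.trans hj.2)
  · intro i a
    rw [Set.mem_toFinset]
    constructor
    · rintro ⟨e, he, hae⟩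
      obtain ⟨b, rfl⟩ := hae
      exact ⟨b, he⟩
    · rintro ⟨b, hb⟩
      exact ⟨s(a, b), hb, by simp⟩
  · intro i
    rw [← Set.ncard_eq_toFinset_card']
    exact two_mul_ncard_cover_block_le i.1 i.2
  · rintro ⟨q, e, he⟩
    induction e using Sym2.ind with
    | _ a b =>
      obtain ⟨c, hac, hbc⟩ := htri a b he.1
      have hab : G.Adj a b := he.1
      have h1 : s(a, c) ∈ (block G q).edgeSet :=
        mem_block_of_step ⟨a, b, c, rfl, rfl, hab, hac, hbc⟩ he
      have h2 : ({a, b, c} : Finset V).card = 3 :=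
        Finset.card_eq_three.2 ⟨a, b, c, hab.ne, hac.ne, hbc.ne, rfl⟩
      rw [← h2]
      refine Finset.card_le_card fun x hx => ?_
      rw [Set.mem_toFinset]
      simp only [Finset.mem_insert, Finset.mem_singleton] at hx
      rcases hx with rfl | rfl | rfl
      · exact ⟨_, h1, by simp⟩
      · exact ⟨_, he, by simp⟩
      · exact ⟨_, h1, by simp⟩

/-! ### Numbering a ring. -/

/-- A connected incidence structure in which each block carries exactly two points and each point
lies on exactly two blocks is a ring, which may be numbered from any incident pair. -/
theorem exists_ring_numbering {W Q : Type*} [Finite W] [Finite Q] {k : ℕ} (hk : Nat.card Q = k)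
    (inc : W → Q → Prop)
    (hα : ∀ w q, inc w q → ∃ w', w' ≠ w ∧ ∀ x, inc x q ↔ x = w ∨ x = w')
    (hβ : ∀ w q, inc w q → ∃ q', q' ≠ q ∧ ∀ r, inc w r ↔ r = q ∨ r = q')
    (hconn : ∀ S : Set Q, S.Nonempty → (∀ q ∈ S, ∀ w r, inc w q → inc w r → r ∈ S) → ∀ q, q ∈ S)
    {w₀ : W} {q₀ : Q} (h₀ : inc w₀ q₀) :
    ∃ (w : ZMod k → W) (c : ZMod k → Q), Function.Injective w ∧ Function.Bijective c ∧
      (∀ i x, inc x (c i) ↔ x = w i ∨ x = w (i + 1)) ∧ c 1 = q₀ ∧ w 1 = w₀ := by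
  let F := {p : W × Q // inc p.1 p.2}
  choose A hA1 hA2 using hα
  choose B hB1 hB2 using hβ
  -- On incident pairs, α exchanges the point and β the block. Both are involutions without fixed
  -- points, and β ∘ α moves one step around the ring.
  let α : F → F := fun f => ⟨(A _ _ f.2, f.1.2), (hA2 _ _ f.2 _).2 (Or.inr rfl)⟩
  let β : F → F := fun f => ⟨(f.1.1, B _ _ f.2), (hB2 _ _ f.2 _).2 (Or.inr rfl)⟩
  have hα_ne : ∀ f, α f ≠ f := fun f h => hA1 _ _ f.2 (congrArg (fun g : F => g.1.1) h)
  have hβ_ne : ∀ f, β f ≠ f := fun f h => hB1 _ _ f.2 (congrArg (fun g : F => g.1.2) h)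
  have hα_of : ∀ f g : F, f.1.2 = g.1.2 → g = f ∨ g = α f := by
    rintro ⟨⟨a, q⟩, hf⟩ ⟨⟨b, r⟩, hg⟩ h
    obtain rfl : q = r := h
    rcases (hA2 _ _ hf b).1 hg with rfl | rfl
    · exact Or.inl rfl
    · exact Or.inr rfl
  have hβ_of : ∀ f g : F, f.1.1 = g.1.1 → g = f ∨ g = β f := by
    rintro ⟨⟨a, q⟩, hf⟩ ⟨⟨b, r⟩, hg⟩ h
    obtain rfl : a = b := h
    rcases (hB2 _ _ hf r).1 hg with rfl | rfl
    · exact Or.inl rfl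
    · exact Or.inr rfl
  have hαα : ∀ f, α (α f) = f := fun f =>
    ((hα_of (α f) f rfl).resolve_left (hα_ne f).symm).symm
  have hββ : ∀ f, β (β f) = f := fun f =>
    ((hβ_of (β f) f rfl).resolve_left (hβ_ne f).symm).symm
  let φ : F → F := fun f => β (α f)
  have hφ_inj : Function.Injective φ := by
    intro f g h
    rw [← hαα f, ← hαα g, ← hββ (α f), ← hββ (α g)]
    exact congrArg (fun x => α (β x)) h
  -- The two orientations of the ring never mix: cancelling one step at each end turns φ^[d + 2] f =
  -- α f into φ^[d] (φ f) = α (φ f), and the cases d = 0, 1 would be fixed points of α or β.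
  have hne : ∀ d f, φ^[d] f ≠ α f := by
    intro d
    induction d using Nat.strong_induction_on with
    | _ d ih =>
      intro f h
      rcases d with _ | _ | d
      · exact hα_ne f h.symm
      · exact hβ_ne (α f) h
      · rw [Function.iterate_succ_apply'] at h
        have h1 : α (φ^[d + 1] f) = φ f := by
          rw [← hββ (α (φ^[d + 1] f))]
          exact congrArg β h
        have h2 : φ^[d + 1] f = α (φ f) := by rw [← h1, hαα]
        exact ih d (by omega) (φ f) (by rw [← h2, Function.iterate_succ_apply])
  have hne' : ∀ a b f, φ^[a] f ≠ α (φ^[b] f) := by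
    intro a b f h
    rcases le_total b a with hab | hab
    · obtain ⟨d, rfl⟩ := Nat.exists_eq_add_of_le' hab
      rw [Function.iterate_add_apply] at h
      exact hne d _ h
    · obtain ⟨d, rfl⟩ := Nat.exists_eq_add_of_le' hab
      rw [Function.iterate_add_apply] at h
      exact hne d (φ^[a] f) (by conv_rhs => rw [h, hαα])
  let f₀ : F := ⟨(w₀, q₀), h₀⟩
  obtain ⟨p, hp⟩ : ∃ p, p = Function.minimalPeriod φ f₀ := ⟨_, rfl⟩
  have hp0 : 0 < p := by
    rw [hp]
    exact Function.minimalPeriod_pos_of_mem_periodicPts (hφ_inj.mem_periodicPts f₀)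
  have : NeZero p := ⟨hp0.ne'⟩
  have hmod : ∀ m, φ^[m % p] f₀ = φ^[m] f₀ := fun m => by
    rw [hp, Function.iterate_mod_minimalPeriod_eq]
  -- The shift by 1 puts the prescribed incident pair at index 1.
  let f : ZMod p → F := fun i => φ^[(i - 1).val] f₀
  have hf_succ : ∀ i, f (i + 1) = φ (f i) := by
    intro i
    have : (i + 1 - 1 : ZMod p).val = ((i - 1).val + 1) % p := by
      rw [show (i + 1 - 1 : ZMod p) = (((i - 1).val + 1 : ℕ) : ZMod p) by simp, ZMod.val_natCast]
    simp only [f]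
    rw [this, hmod, Function.iterate_succ_apply']
  have hf_inj : Function.Injective f := by
    intro i j h
    have h1 : (i - 1).val = (j - 1).val :=
      Function.iterate_injOn_Iio_minimalPeriod (f := φ) (x := f₀)
        (by rw [Set.mem_Iio, ← hp]; exact ZMod.val_lt _)
        (by rw [Set.mem_Iio, ← hp]; exact ZMod.val_lt _) h
    simpa using ZMod.val_injective p h1
  have hfα : ∀ i j, f i ≠ α (f j) := fun i j => hne' _ _ f₀
  have hw_inj : ∀ i j, (f i).1.1 = (f j).1.1 → i = j := by
    intro i j h
    rcases hβ_of _ _ h with h1 | h1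
    · exact (hf_inj h1).symm
    · refine absurd ?_ (hfα j (i - 1))
      have h2 : f i = φ (f (i - 1)) := by rw [← hf_succ, sub_add_cancel]
      rw [h1, h2]
      exact hββ _
  have hc_inj : ∀ i j, (f i).1.2 = (f j).1.2 → i = j := by
    intro i j h
    rcases hα_of _ _ h with h1 | h1
    · exact (hf_inj h1).symm
    · exact absurd h1 (hfα j i)
  have hw_succ : ∀ i, (f (i + 1)).1.1 = A _ _ (f i).2 := fun i => by rw [hf_succ]
  have hinc : ∀ i x, inc x (f i).1.2 ↔ x = (f i).1.1 ∨ x = (f (i + 1)).1.1 := by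
    intro i x
    rw [hw_succ]
    exact hA2 _ _ (f i).2 x
  have hinc' : ∀ i r, inc (f (i + 1)).1.1 r → r = (f i).1.2 ∨ r = (f (i + 1)).1.2 := by
    intro i r h
    have h1 : f (i + 1) = β (α (f i)) := hf_succ i
    rw [h1] at h ⊢
    exact (hB2 _ _ (α (f i)).2 r).1 h
  -- The blocks met by the orbit are closed under passing to a block with a common point;
  -- connectedness then makes the period equal to the number of blocks.
  have hc_surj : ∀ q, q ∈ Set.range fun i => (f i).1.2 := by
    refine hconn _ ⟨_, 0, rfl⟩ ?_
    rintro _ ⟨i, rfl⟩ x r hx hr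
    rcases (hinc i x).1 hx with rfl | rfl
    · have := hinc' (i - 1) r (by rwa [sub_add_cancel])
      rw [sub_add_cancel] at this
      rcases this with rfl | rfl
      · exact ⟨_, rfl⟩
      · exact ⟨_, rfl⟩
    · rcases hinc' i r hr with rfl | rfl
      · exact ⟨_, rfl⟩
      · exact ⟨_, rfl⟩
  have hbij : Function.Bijective fun i => (f i).1.2 := ⟨fun i j => hc_inj i j, hc_surj⟩
  obtain rfl : p = k := by
    rw [← hk, ← Nat.card_congr (Equiv.ofBijective _ hbij), Nat.card_zmod]
  refine ⟨fun i => (f i).1.1, fun i => (f i).1.2, fun i j => hw_inj i j, hbij, hinc, ?_, ?_⟩ <;>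
    simp [f, f₀]

/-! ### The counting identity and its equality case. -/

section Counting

variable {V : Type w} [DecidableEq V] {ι : Type*} [Fintype ι]

/-- The number of the sets `S i` that contain `x`. -/
def mult (S : ι → Finset V) (x : V) : ℕ := (Finset.univ.filter fun i => x ∈ S i).card

/-- The elements of `S i` that lie in some other set of the family. -/
def shared (S : ι → Finset V) (i : ι) : Finset V := (S i).filter fun x => 2 ≤ mult S x

theorem shared_subset (S : ι → Finset V) (i : ι) : shared S i ⊆ S i := Finset.filter_subset _ _

theorem two_le_mult {S : ι → Finset V} {i j : ι} (hij : i ≠ j) {x : V} (hi : x ∈ S i) (hj : x ∈ S j) :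
    2 ≤ mult S x := by
  rw [mult, Nat.succ_le_iff, Finset.one_lt_card]
  exact ⟨i, by simpa using hi, j, by simpa using hj, hij⟩

theorem eq_of_mem_of_mult_lt {S : ι → Finset V} {i j : ι} {x : V} (hx : mult S x < 2) (hi : x ∈ S i) (hj : x ∈ S j) : i = j := by
  by_contra h
  exact absurd (two_le_mult h hi hj) (by omega)

variable [Fintype V]

/-- After summing over vertices instead of blocks, a vertex in μ ≥ 2 blocks contributes (3μ - 6) -
6μ + 3μ + 6 = 0, and one in a single block -6 + 6 = 0. -/
theorem sum_excess (S : ι → Finset V) (hS : ∀ x, 1 ≤ mult S x) (e : ι → ℕ) :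
    ∑ i, (4 * (e i : ℤ) - 6 * (S i).card + 3 * (shared S i).card) +
      ∑ x, (if 2 ≤ mult S x then 3 * (mult S x : ℤ) - 6 else 0) + 6 * Fintype.card V =
    4 * ∑ i, (e i : ℤ) := by
  have h1 : ∑ i, ((S i).card : ℤ) = ∑ x, (mult S x : ℤ) := by
    have : ∑ i, (S i).card = ∑ x, mult S x := by
      simp only [Finset.card_eq_sum_ones, mult, Finset.sum_filter]
      rw [Finset.sum_comm]
      refine Finset.sum_congr rfl fun i _ => ?_
      simp
    exact_mod_cast this
  have h2 : ∑ i, ((shared S i).card : ℤ) = ∑ x, if 2 ≤ mult S x then (mult S x : ℤ) else 0 := by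
    have : ∑ i, (shared S i).card = ∑ x, if 2 ≤ mult S x then mult S x else 0 := by
      have : ∀ x, (if 2 ≤ mult S x then mult S x else 0) =
          ∑ i, if x ∈ shared S i then 1 else 0 := by
        intro x
        split_ifs with hx
        · simp only [shared, Finset.mem_filter, hx, and_true]
          simp [mult]
        · simp [shared, hx]
      simp only [this]
      rw [Finset.sum_comm]
      refine Finset.sum_congr rfl fun i _ => ?_
      simp
    rw [← Nat.cast_sum, this]
    push_cast
    rfl
  have h3 : (Fintype.card V : ℤ) = ∑ _x : V, (1 : ℤ) := by simp
  rw [Finset.sum_add_distrib, Finset.sum_sub_distrib, ← Finset.mul_sum, ← Finset.mul_sum,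
    ← Finset.mul_sum, h1, h2, h3]
  suffices h : ∑ x, ((if 2 ≤ mult S x then 3 * (mult S x : ℤ) - 6 else 0) -
      6 * (mult S x : ℤ) + 3 * (if 2 ≤ mult S x then (mult S x : ℤ) else 0) + 6 * 1) = 0 by
    rw [Finset.sum_add_distrib, Finset.sum_add_distrib, Finset.sum_sub_distrib, ← Finset.mul_sum,
      ← Finset.mul_sum, ← Finset.mul_sum] at h
    linarith
  refine Finset.sum_eq_zero fun x _ => ?_
  have := hS x
  split_ifs with hx
  · ring
  · have : mult S x = 1 := by omega
    rw [this]
    norm_num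

namespace IsBlockDecomposition

variable {G : SimpleGraph V} {B : ι → SimpleGraph V} {S : ι → Finset V}

theorem sum_ncard_edgeSet (D : IsBlockDecomposition G B S) :
    ∑ i, (B i).edgeSet.ncard = G.edgeSet.ncard := by
  classical
  have h : G.edgeSet.toFinset = Finset.univ.biUnion fun i => (B i).edgeSet.toFinset := by
    ext e
    induction e using Sym2.ind with
    | _ a b =>
      simp only [Set.mem_toFinset, SimpleGraph.mem_edgeSet, Finset.mem_biUnion, Finset.mem_univ,
        true_and]
      exact ⟨D.exists_adj, fun ⟨_, h⟩ => D.adj h⟩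
  rw [Set.ncard_eq_toFinset_card', h, Finset.card_biUnion]
  · exact Finset.sum_congr rfl fun i _ => Set.ncard_eq_toFinset_card' _
  · intro i _ j _ hij
    refine Finset.disjoint_left.2 fun e hi hj => ?_
    rw [Set.mem_toFinset] at hi hj
    induction e using Sym2.ind with
    | _ a b => exact hij (D.unique hi hj)

theorem one_le_mult (D : IsBlockDecomposition G B S) (hG : IsTwoConnected G) (x : V) :
    1 ≤ mult S x := by
  obtain ⟨y, hy⟩ := Fintype.exists_ne_of_one_lt_card (by have := hG.1; omega) x
  have : ∃ z, G.Adj x z := by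
    by_contra! hcon
    exact hy (((connected_iff_closed G).1 hG.2.1).2 {x} ⟨x, rfl⟩
      (fun a ha b hab => absurd (ha ▸ hab) (hcon b)) y)
  obtain ⟨z, hz⟩ := this
  obtain ⟨i, hi⟩ := D.exists_adj hz
  rw [mult, Nat.succ_le_iff, Finset.card_pos]
  exact ⟨i, by simpa using D.mem_left hi⟩

theorem exists_mem (D : IsBlockDecomposition G B S) (hG : IsTwoConnected G) (x : V) :
    ∃ i, x ∈ S i := by
  have := D.one_le_mult hG x
  rw [mult, Nat.succ_le_iff, Finset.card_pos] at this
  obtain ⟨i, hi⟩ := this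
  exact ⟨i, by simpa using hi⟩

/-- Edges at an unshared vertex stay in its block. With at most one shared vertex x, deleting x
would thus cut the rest of the block off from the outside. The outside is nonempty, since otherwise
all of `S j` would be shared. -/
theorem two_le_card_shared (D : IsBlockDecomposition G B S) (hG : IsTwoConnected G) {i j : ι}
    (hij : j ≠ i) : 2 ≤ (shared S i).card := by
  by_contra! hcon
  have hout : ∃ a, a ∉ S i := by
    by_contra! hall
    have hsub : S j ⊆ shared S i := fun x hx =>
      Finset.mem_filter.2 ⟨hall x, two_le_mult hij hx (hall x)⟩
    have := Finset.card_le_card hsub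
    have := D.three_le_card j
    omega
  obtain ⟨a, ha⟩ := hout
  obtain ⟨x, hx, hsh⟩ : ∃ x ∈ S i, ∀ y ∈ S i, y ≠ x → mult S y < 2 := by
    rcases (shared S i).eq_empty_or_nonempty with h | ⟨x, hx⟩
    · obtain ⟨x, hx⟩ : (S i).Nonempty := Finset.card_pos.1 (by have := D.three_le_card i; omega)
      refine ⟨x, hx, fun y hy _ => ?_⟩
      by_contra! h2
      have : y ∈ shared S i := Finset.mem_filter.2 ⟨hy, h2⟩
      simp [h] at this
    · refine ⟨x, (Finset.mem_filter.1 hx).1, fun y hy hyx => ?_⟩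
      by_contra! h2
      have h1 : (shared S i).card ≤ 1 := by omega
      exact hyx (Finset.card_le_one.1 h1 y (Finset.mem_filter.2 ⟨hy, h2⟩) x hx)
  obtain ⟨b, hb⟩ : ((S i).erase x).Nonempty := by
    rw [← Finset.card_pos, Finset.card_erase_of_mem hx]
    have := D.three_le_card i
    omega
  have := ((isTwoConnected_iff_noCut G).1 hG).2 x ((S i).erase x) ⟨b, hb⟩ (by simp)
    (by
      intro c hc d hcd hd
      rw [Finset.mem_coe, Finset.mem_erase] at hc ⊢
      obtain ⟨l, hl⟩ := D.exists_adj hcd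
      obtain rfl : l = i := eq_of_mem_of_mult_lt (hsh c hc.2 hc.1) (D.mem_left hl) hc.2
      exact ⟨hd, D.mem_right hl⟩) a (fun h => ha (h ▸ hx))
  exact ha (Finset.mem_of_mem_erase this)

/-- Inserting e ≥ 2c - 3 and s ≥ 2 leaves at least 2c - 6, and c ≥ 3. -/
theorem excess_nonneg (D : IsBlockDecomposition G B S) (hG : IsTwoConnected G) [Nontrivial ι]
    (i : ι) :
    0 ≤ 4 * ((B i).edgeSet.ncard : ℤ) - 6 * (S i).card + 3 * (shared S i).card := by
  obtain ⟨j, hj⟩ := exists_ne i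
  have h1 := D.two_le_card_shared hG hj
  have h2 := D.three_le_card i
  have h3 := D.two_mul_card_le i
  omega

theorem card_le_of_subsingleton (D : IsBlockDecomposition G B S) (hG : IsTwoConnected G)
    [Subsingleton ι] : 2 * Fintype.card V ≤ G.edgeSet.ncard + 3 := by
  have : Nonempty V := hG.2.1.nonempty
  obtain ⟨i, -⟩ := D.exists_mem hG (Classical.arbitrary V)
  have hS : S i = Finset.univ := by
    ext x
    obtain ⟨j, hj⟩ := D.exists_mem hG x
    simpa [Subsingleton.elim i j] using hj
  have h1 := D.two_mul_card_le i
  have h2 := D.sum_ncard_edgeSet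
  rw [Fintype.sum_subsingleton _ i] at h2
  rw [hS, Finset.card_univ] at h1
  omega

theorem sum_excess_le (D : IsBlockDecomposition G B S) (hG : IsTwoConnected G) :
    ∑ i, (4 * ((B i).edgeSet.ncard : ℤ) - 6 * (S i).card + 3 * (shared S i).card) +
      ∑ x, (if 2 ≤ mult S x then 3 * (mult S x : ℤ) - 6 else 0) + 6 * Fintype.card V =
    4 * G.edgeSet.ncard := by
  rw [sum_excess S (D.one_le_mult hG) fun i => (B i).edgeSet.ncard, ← D.sum_ncard_edgeSet]
  push_cast
  rfl

theorem three_mul_card_le (D : IsBlockDecomposition G B S) (hG : IsTwoConnected G)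
    (hV : 6 ≤ Fintype.card V) : 3 * Fintype.card V ≤ 2 * G.edgeSet.ncard := by
  rcases subsingleton_or_nontrivial ι with h | h
  · have := D.card_le_of_subsingleton hG
    omega
  · have h1 := D.sum_excess_le hG
    have h2 := Finset.sum_nonneg fun i (_ : i ∈ Finset.univ) => D.excess_nonneg hG i
    have h3 : 0 ≤ ∑ x, (if 2 ≤ mult S x then 3 * (mult S x : ℤ) - 6 else 0) :=
      Finset.sum_nonneg fun x _ => by split_ifs <;> omega
    omega

/-- In the extremal case every vertex is in at most two blocks, every block has exactly two shared
vertices, and the blocks have the least possible number of edges; the excess over `3 n / 2` comes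
from blocks with more than three vertices. -/
theorem extremal (D : IsBlockDecomposition G B S) (hG : IsTwoConnected G)
    (hV : 8 ≤ Fintype.card V) (hm : 2 * G.edgeSet.ncard ≤ 3 * Fintype.card V + 1) :
    (∀ x, mult S x ≤ 2) ∧ (∀ i, (shared S i).card = 2) ∧
      (∀ i, (B i).edgeSet.ncard + 3 = 2 * (S i).card) ∧
      (2 * ∑ i, ((S i).card - 3) + 6 * Fintype.card V = 4 * G.edgeSet.ncard) := by
  rcases subsingleton_or_nontrivial ι with h | h
  · have := D.card_le_of_subsingleton hG
    omega
  have h1 := D.sum_excess_le hG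
  have hx0 : ∀ x, 0 ≤ (if 2 ≤ mult S x then 3 * (mult S x : ℤ) - 6 else 0) := fun x => by
    split_ifs <;> omega
  have h2 := Finset.sum_nonneg fun i (_ : i ∈ Finset.univ) => D.excess_nonneg hG i
  have h3 := Finset.sum_nonneg fun x (_ : x ∈ Finset.univ) => hx0 x
  -- The nonnegative terms sum to at most 2, while a vertex in three blocks costs 3, a third shared
  -- vertex of a block 3, and an edge beyond 2c - 3 costs 4.
  have hmult : ∀ x, mult S x ≤ 2 := by
    intro x
    have := Finset.single_le_sum (fun x _ => hx0 x) (Finset.mem_univ x)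
    split_ifs at this <;> omega
  have hi : ∀ i, (shared S i).card = 2 ∧ (B i).edgeSet.ncard + 3 = 2 * (S i).card := by
    intro i
    have h4 := Finset.single_le_sum (fun i _ => D.excess_nonneg hG i) (Finset.mem_univ i)
    obtain ⟨j, hj⟩ := exists_ne i
    have h5 := D.two_le_card_shared hG hj
    have h6 := D.three_le_card i
    have h7 := D.two_mul_card_le i
    omega
  refine ⟨hmult, fun i => (hi i).1, fun i => (hi i).2, ?_⟩
  have h4 : ∑ x, (if 2 ≤ mult S x then 3 * (mult S x : ℤ) - 6 else 0) = 0 :=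
    Finset.sum_eq_zero fun x _ => by have := hmult x; split_ifs <;> omega
  have h5 : ∑ i, (4 * ((B i).edgeSet.ncard : ℤ) - 6 * (S i).card + 3 * (shared S i).card) =
      2 * ((∑ i, ((S i).card - 3) : ℕ) : ℤ) := by
    rw [Nat.cast_sum, Finset.mul_sum]
    refine Finset.sum_congr rfl fun i _ => ?_
    have := hi i
    have := D.three_le_card i
    omega
  omega

/-- The points of the ring are the shared vertices: each lies in exactly two blocks, each block has
two of them, and connectedness of `G` passes to the blocks. -/
theorem exists_ring_numbering (D : IsBlockDecomposition G B S) (hG : IsTwoConnected G)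
    (hmult : ∀ x, mult S x ≤ 2) (hsh : ∀ i, (shared S i).card = 2) {k : ℕ}
    (hk : Fintype.card ι = k) {i₀ : ι} {x₀ : V} (h₀ : x₀ ∈ shared S i₀) :
    ∃ (w : ZMod k → V) (c : ZMod k → ι), Function.Injective w ∧ Function.Bijective c ∧
      (∀ i x, x ∈ shared S (c i) ↔ x = w i ∨ x = w (i + 1)) ∧ c 1 = i₀ ∧ w 1 = x₀ := by
  classical
  refine TriangleRing.exists_ring_numbering (by rwa [Nat.card_eq_fintype_card])
    (fun x i => x ∈ shared S i) ?_ ?_ ?_ h₀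
  · intro x i hx
    obtain ⟨a, b, hab, h⟩ := Finset.card_eq_two.1 (hsh i)
    rw [h] at hx ⊢
    simp only [Finset.mem_insert, Finset.mem_singleton] at hx ⊢
    rcases hx with rfl | rfl
    · exact ⟨b, hab.symm, fun y => Iff.rfl⟩
    · exact ⟨a, hab, fun y => or_comm⟩
  · intro x i hx
    have hx2 := (Finset.mem_filter.1 hx).2
    obtain ⟨a, b, hab, h⟩ := Finset.card_eq_two.1 (le_antisymm (hmult x) hx2)
    have h' : ∀ j, x ∈ shared S j ↔ j = a ∨ j = b := by
      intro j
      have : j ∈ Finset.univ.filter (fun j => x ∈ S j) ↔ j = a ∨ j = b := by simp [h]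
      rw [← this]
      simp [shared, hx2]
    rcases (h' i).1 hx with rfl | rfl
    · exact ⟨b, hab.symm, h'⟩
    · exact ⟨a, hab, fun j => (h' j).trans or_comm⟩
  · rintro T ⟨i, hi⟩ hT j
    have hT' : ∀ l ∈ T, ∀ x r, x ∈ S l → x ∈ S r → r ∈ T := by
      intro l hl x r hxl hxr
      by_cases hlr : l = r
      · exact hlr ▸ hl
      · have h2 := two_le_mult hlr hxl hxr
        exact hT l hl x r (Finset.mem_filter.2 ⟨hxl, h2⟩) (Finset.mem_filter.2 ⟨hxr, h2⟩)
    have hne : ∀ l, (S l).Nonempty := fun l =>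
      Finset.card_pos.1 (by have := D.three_le_card l; omega)
    obtain ⟨y, hy⟩ := hne j
    obtain ⟨x, hx⟩ := hne i
    obtain ⟨l, hl, hyl⟩ := ((connected_iff_closed G).1 hG.2.1).2 {x | ∃ l ∈ T, x ∈ S l}
      ⟨x, i, hi, hx⟩ (by
        rintro a ⟨l, hl, hal⟩ b hab
        obtain ⟨r, hr⟩ := D.exists_adj hab
        exact ⟨r, hT' l hl a r hal (D.mem_left hr), D.mem_right hr⟩) y
    exact hT' l hl y j hyl hy

end IsBlockDecomposition

end Counting

/-! ### The graphs F_n, G_n and H_n. -/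

theorem EveryEdgeInTriangle.addVertex {V : Type*} {G : SimpleGraph V} (h : EveryEdgeInTriangle G)
    {s t : V} (hst : G.Adj s t) : EveryEdgeInTriangle (addVertex G {s, t}) := by
  rintro (_ | a) (_ | b) hab
  · exact hab.elim
  · rcases hab with rfl | rfl
    · exact ⟨some t, Or.inr rfl, hst⟩
    · exact ⟨some s, Or.inl rfl, hst.symm⟩
  · rcases hab with rfl | rfl
    · exact ⟨some t, hst, Or.inr rfl⟩
    · exact ⟨some s, hst.symm, Or.inl rfl⟩
  · obtain ⟨c, h1, h2⟩ := h a b hab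
    exact ⟨some c, h1, h2⟩

/-- Only the first cell contains both v_1 and v_2, because q ≥ 3. -/
theorem eq_one_of_mem_cell {q : ℕ} (hq : 3 ≤ q) {i : ZMod q} (h1 : Sum.inl 1 ∈ cell i)
    (h2 : Sum.inl (1 + 1) ∈ cell i) : i = 1 := by
  have h3 := zmod_two_ne_zero hq
  simp only [cell, Set.mem_insert_iff, Set.mem_singleton_iff, Sum.inl.injEq, reduceCtorEq,
    or_false] at h1 h2
  rcases h1 with h1 | h1
  · exact h1.symm
  · rcases h2 with h2 | h2
    · rw [← h2, ← sub_eq_zero] at h1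
      exact absurd (by linear_combination -h1) h3
    · exact (add_right_cancel h2).symm

/-- The cells of `A_n` together with a new vertex in the first cell. -/
def optionCell {q : ℕ} (i : ZMod q) : Set (Option (ZMod q ⊕ ZMod q)) :=
  {a | (a = none ∧ i = 1) ∨ ∃ b ∈ cell i, a = some b}

@[simp] theorem none_mem_optionCell {q : ℕ} (i : ZMod q) : none ∈ optionCell i ↔ i = 1 := by
  simp [optionCell]

@[simp] theorem some_mem_optionCell {q : ℕ} (i : ZMod q) (a : ZMod q ⊕ ZMod q) :
    some a ∈ optionCell i ↔ a ∈ cell i := by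
  simp [optionCell, -Sum.exists]

/-- F_n, G_n and H_n get one common description: the first cell is enlarged by the new vertex, and
they differ only in the single pair missing from its K_4. -/
theorem graphF_adj {n : ℕ} (hn : 2 ≤ (n - 1) / 2) (a b) : (graphF n).Adj a b ↔
    a ≠ b ∧ s(a, b) ≠ s(none, some (Sum.inr 1)) ∧ ∃ i, a ∈ optionCell i ∧ b ∈ optionCell i := by
  rcases a with _ | a <;> rcases b with _ | b
  · simp [graphF, addVertex]
  · simp [graphF, addVertex, cell, v, one_add_one_eq_two]
    grind
  · simp [graphF, addVertex, cell, v, one_add_one_eq_two]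
    grind
  · simp [graphF, addVertex, graphA_adj hn]

theorem graphG_adj {n : ℕ} (hn : 2 ≤ (n - 1) / 2) (a b) : (graphG n).Adj a b ↔
    a ≠ b ∧ s(a, b) ≠ s(none, some (Sum.inl (1 + 1))) ∧
      ∃ i, a ∈ optionCell i ∧ b ∈ optionCell i := by
  have h := zmod_add_one_ne hn 1
  rcases a with _ | a <;> rcases b with _ | b
  · simp [graphG, addVertex]
  · simp [graphG, addVertex, cell, u, v]
    grind
  · simp [graphG, addVertex, cell, u, v]
    grind
  · simp [graphG, addVertex, graphA_adj hn]

theorem graphH_adj {n : ℕ} (hn : 2 ≤ (n - 1) / 2) (a b) : (graphH n).Adj a b ↔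
    a ≠ b ∧ s(a, b) ≠ s(some (Sum.inl 1), some (Sum.inl (1 + 1))) ∧
      ∃ i, a ∈ optionCell i ∧ b ∈ optionCell i := by
  rcases a with _ | a <;> rcases b with _ | b
  · simp [graphH, addVertex]
  · simp [graphH, addVertex, cell, u, v, one_add_one_eq_two]
  · simp [graphH, addVertex, cell, u, v, one_add_one_eq_two]
  · simp [graphH, addVertex, graphA_adj hn, u, v, one_add_one_eq_two]
    grind

/-- In the first cell u_1 and z are joined to everything, so one of them completes any edge except z
u_1, which v_1 completes. The other cells do not contain the deleted pair and keep their triangles.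
-/
theorem everyEdgeInTriangle_graphH {n : ℕ} (hn : 3 ≤ (n - 1) / 2) :
    EveryEdgeInTriangle (graphH n) := by
  have h1 := zmod_add_one_ne (q := (n - 1) / 2) (by omega)
  intro a b hab
  suffices ∃ c, (a ≠ c ∧ s(a, c) ≠ s(some (Sum.inl 1), some (Sum.inl (1 + 1)))) ∧
      (b ≠ c ∧ s(b, c) ≠ s(some (Sum.inl 1), some (Sum.inl (1 + 1)))) ∧
      ∃ i, a ∈ optionCell i ∧ b ∈ optionCell i ∧ c ∈ optionCell i by
    obtain ⟨c, ⟨h1, h2⟩, ⟨h3, h4⟩, i, ha, hb, hc⟩ := this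
    exact ⟨c, (graphH_adj (by omega) _ _).2 ⟨h1, h2, i, ha, hc⟩,
      (graphH_adj (by omega) _ _).2 ⟨h3, h4, i, hb, hc⟩⟩
  obtain ⟨hne, hmiss, i, ha, hb⟩ := (graphH_adj (by omega) a b).1 hab
  by_cases hi : i = 1
  · subst hi
    by_cases hu : a = some (Sum.inr 1) ∨ b = some (Sum.inr 1)
    · by_cases hx : a = none ∨ b = none
      · have hab : (a = some (Sum.inr 1) ∧ b = none) ∨ (a = none ∧ b = some (Sum.inr 1)) := by
          grind
        refine ⟨some (Sum.inl 1), ?_, ?_, 1, ha, hb, by simp [cell]⟩ <;>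
          rcases hab with ⟨rfl, rfl⟩ | ⟨rfl, rfl⟩ <;> simp
      · push Not at hx
        refine ⟨none, ⟨hx.1, by simp⟩, ⟨hx.2, by simp⟩, 1, ha, hb, by simp⟩
    · push Not at hu
      refine ⟨some (Sum.inr 1), ⟨hu.1, by simp⟩, ⟨hu.2, by simp⟩, 1, ha, hb, by simp [cell]⟩
  · rcases a with _ | a
    · simp [hi] at ha
    rcases b with _ | b
    · simp [hi] at hb
    have hcell : ∀ x ∈ cell i, ∀ y ∈ cell i,
        s(some x, some y) ≠ s(some (Sum.inl 1), some (Sum.inl (1 + 1))) := by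
      intro x hx y hy h
      rw [Sym2.eq_iff] at h
      simp only [Option.some.injEq] at h
      rcases h with ⟨rfl, rfl⟩ | ⟨rfl, rfl⟩
      · exact hi (eq_one_of_mem_cell hn hx hy)
      · exact hi (eq_one_of_mem_cell hn hy hx)
    have hab' : (graphA (n - 1)).Adj a b := (graphA_adj (by omega) a b).2
      ⟨fun h => hne (h ▸ rfl), i, by simpa using ha, by simpa using hb⟩
    rw [some_mem_optionCell] at ha hb
    obtain ⟨c, hc, hca, hcb⟩ : ∃ c ∈ cell i, a ≠ c ∧ b ≠ c := by
      have h2 := (h1 i).symm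
      simp only [cell, Set.mem_insert_iff, Set.mem_singleton_iff] at ha hb ⊢
      rcases ha with rfl | rfl | rfl <;> rcases hb with rfl | rfl | rfl <;>
        simp [h1 i, h2] at hne ⊢
    exact ⟨some c, ⟨by simpa using hca, hcell a ha c hc⟩, ⟨by simpa using hcb, hcell b hb c hc⟩, i,
      by simpa using ha, by simpa using hb, by simpa using hc⟩

theorem exists_ne_ne_zmod_sum {q : ℕ} (hq : 2 ≤ q) (a b : ZMod q ⊕ ZMod q) :
    ∃ x, x ≠ a ∧ x ≠ b := by
  have h : ∀ i : ZMod q, i + 1 ≠ i := zmod_add_one_ne hq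
  rcases a with i | i <;> rcases b with j | j
  · exact ⟨Sum.inr 0, by simp⟩
  · exact ⟨Sum.inl (i + 1), by simp [h i]⟩
  · exact ⟨Sum.inl (j + 1), by simp [h j]⟩
  · exact ⟨Sum.inl 0, by simp⟩

theorem noCut_graphF {n : ℕ} (hn : 2 ≤ (n - 1) / 2) : NoCut (graphF n) :=
  (noCut_graphA hn).addVertex (s := v 1) (t := v 2) (by simp) (by simp)
    (by simpa [v, ← one_add_one_eq_two] using (zmod_add_one_ne hn 1).symm)
    (exists_ne_ne_zmod_sum hn)

theorem noCut_graphG {n : ℕ} (hn : 2 ≤ (n - 1) / 2) : NoCut (graphG n) :=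
  (noCut_graphA hn).addVertex (s := u 1) (t := v 1) (by simp) (by simp) (by simp [u, v])
    (exists_ne_ne_zmod_sum hn)

theorem noCut_graphH {n : ℕ} (hn : 2 ≤ (n - 1) / 2) : NoCut (graphH n) := by
  have h := noCut_graphA_deleteEdges hn 1
  rw [one_add_one_eq_two] at h
  exact h.addVertex (s := v 1) (t := u 1) (by simp) (by simp) (by simp [u, v])
    (exists_ne_ne_zmod_sum hn)

theorem everyEdgeInTriangle_graphF {n : ℕ} (hn : 2 ≤ (n - 1) / 2) :
    EveryEdgeInTriangle (graphF n) :=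
  (everyEdgeInTriangle_graphA hn).addVertex ((graphA_adj hn _ _).2
    ⟨by simpa [v, ← one_add_one_eq_two] using (zmod_add_one_ne hn 1).symm, 1,
      by simp [v, cell], by simp [v, cell, one_add_one_eq_two]⟩)

theorem everyEdgeInTriangle_graphG {n : ℕ} (hn : 2 ≤ (n - 1) / 2) :
    EveryEdgeInTriangle (graphG n) :=
  (everyEdgeInTriangle_graphA hn).addVertex ((graphA_adj hn _ _).2
    ⟨by simp [u, v], 1, by simp [u, cell], by simp [v, cell]⟩)

theorem ncard_edgeSet_graphF {n : ℕ} (hn : 3 ≤ (n - 1) / 2) :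
    (graphF n).edgeSet.ncard = 3 * ((n - 1) / 2) + 2 := by
  have : NeZero ((n - 1) / 2) := ⟨by omega⟩
  rw [graphF, ncard_edgeSet_addVertex, ncard_edgeSet_graphA hn, Set.ncard_pair]
  simpa [v, ← one_add_one_eq_two] using (zmod_add_one_ne (show 2 ≤ (n - 1) / 2 by omega) 1).symm

theorem ncard_edgeSet_graphG {n : ℕ} (hn : 3 ≤ (n - 1) / 2) :
    (graphG n).edgeSet.ncard = 3 * ((n - 1) / 2) + 2 := by
  have : NeZero ((n - 1) / 2) := ⟨by omega⟩
  rw [graphG, ncard_edgeSet_addVertex, ncard_edgeSet_graphA hn, Set.ncard_pair]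
  simp [u, v]

theorem ncard_edgeSet_graphH {n : ℕ} (hn : 3 ≤ (n - 1) / 2) :
    (graphH n).edgeSet.ncard = 3 * ((n - 1) / 2) + 2 := by
  have : NeZero ((n - 1) / 2) := ⟨by omega⟩
  have h12 : v (n := n - 1) 1 ≠ v (n := n - 1) 2 := by
    simpa [v, ← one_add_one_eq_two] using (zmod_add_one_ne (show 2 ≤ (n - 1) / 2 by omega) 1).symm
  have hmem : s(v (n := n - 1) 1, v (n := n - 1) 2) ∈ (graphA (n - 1)).edgeSet :=
    (graphA_adj (by omega) _ _).2
      ⟨h12, 1, by simp [v, cell], by simp [v, cell, one_add_one_eq_two]⟩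
  have h1 : ({v (n := n - 1) 1, v (n := n - 1) 2, u (n := n - 1) 1} : Set _).ncard = 3 := by
    rw [Set.ncard_insert_of_notMem (by simp [h12]; simp [u, v]), Set.ncard_pair (by simp [u, v])]
  rw [graphH, ncard_edgeSet_addVertex, SimpleGraph.edgeSet_deleteEdges,
    Set.ncard_sdiff_singleton_of_mem hmem, ncard_edgeSet_graphA hn, h1]
  omega

theorem isTwoConnected_and_ncard_of_iso {V W : Type*} [Fintype V] {G : SimpleGraph V}
    {H : SimpleGraph W} (e : G ≃g H) (hV : 3 ≤ Fintype.card V) (h1 : NoCut H)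
    (h2 : EveryEdgeInTriangle H) :
    IsTwoConnected G ∧ EveryEdgeInTriangle G ∧ G.edgeSet.ncard = H.edgeSet.ncard :=
  ⟨(isTwoConnected_iff_noCut G).2 ⟨hV, h1.of_iso e⟩, h2.of_iso e, Nat.card_congr e.mapEdgeSet⟩

/-! ### Complete graphs and complete graphs without one edge. -/

theorem edgeSet_toFinset_subset {V : Type*} [Fintype V] [DecidableEq V] {B : SimpleGraph V}
    [DecidableRel B.Adj] {S : Finset V} (hB : ∀ a b, B.Adj a b → a ∈ S) :
    B.edgeSet.toFinset ⊆ S.offDiag.image Sym2.mk.uncurry := by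
  intro e he
  induction e using Sym2.ind with
  | _ a b =>
    have hab : B.Adj a b := by simpa using he
    exact Finset.mem_image.2 ⟨(a, b),
      Finset.mem_offDiag.2 ⟨hB a b hab, hB b a hab.symm, hab.ne⟩, rfl⟩

/-- A graph on `S` with the maximal number of edges is complete. -/
theorem adj_of_ncard_eq_choose {V : Type*} [Fintype V] [DecidableEq V] {B : SimpleGraph V}
    {S : Finset V} (hB : ∀ a b, B.Adj a b → a ∈ S) (hc : B.edgeSet.ncard = S.card.choose 2)
    {a b : V} (ha : a ∈ S) (hb : b ∈ S) (hab : a ≠ b) : B.Adj a b := by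
  classical
  have h := Finset.eq_of_subset_of_card_le (edgeSet_toFinset_subset hB) (by
    rw [Sym2.card_image_offDiag, ← hc, Set.ncard_eq_toFinset_card'])
  have : s(a, b) ∈ B.edgeSet.toFinset := by
    rw [h]
    exact Finset.mem_image.2 ⟨(a, b), Finset.mem_offDiag.2 ⟨ha, hb, hab⟩, rfl⟩
  simpa using this

/-- A graph on `S` with one edge less than the maximal number misses exactly one pair. -/
theorem exists_missing_of_ncard_eq {V : Type*} [Fintype V] [DecidableEq V] {B : SimpleGraph V}
    {S : Finset V} (hB : ∀ a b, B.Adj a b → a ∈ S) (hc : B.edgeSet.ncard + 1 = S.card.choose 2) :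
    ∃ p ∈ S, ∃ r ∈ S, p ≠ r ∧ ¬ B.Adj p r ∧
      ∀ a ∈ S, ∀ b ∈ S, a ≠ b → s(a, b) ≠ s(p, r) → B.Adj a b := by
  classical
  have hsub := edgeSet_toFinset_subset hB
  have h1 : (S.offDiag.image Sym2.mk.uncurry \ B.edgeSet.toFinset).card = 1 := by
    rw [Finset.card_sdiff_of_subset hsub, Sym2.card_image_offDiag, ← hc,
      Set.ncard_eq_toFinset_card']
    omega
  obtain ⟨e, he⟩ := Finset.card_eq_one.1 h1
  have hmem : ∀ f, f = e ↔ f ∈ S.offDiag.image Sym2.mk.uncurry ∧ f ∉ B.edgeSet.toFinset := by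
    intro f
    rw [← Finset.mem_sdiff, he, Finset.mem_singleton]
  obtain ⟨hin, hout⟩ := (hmem e).1 rfl
  obtain ⟨⟨p, r⟩, hpr, rfl⟩ := Finset.mem_image.1 hin
  obtain ⟨hp, hr, hne⟩ := Finset.mem_offDiag.1 hpr
  refine ⟨p, hp, r, hr, hne, by simpa using hout, fun a ha b hb hab hs => ?_⟩
  by_contra hn
  exact hs ((hmem s(a, b)).2 ⟨Finset.mem_image.2 ⟨(a, b), Finset.mem_offDiag.2 ⟨ha, hb, hab⟩, rfl⟩,
    by simpa using hn⟩)

theorem exists_mem_iff_insert {V : Type*} [DecidableEq V] {s t : Finset V} (h : s ⊆ t)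
    (hc : s.card + 1 = t.card) : ∃ z, ∀ x, x ∈ t ↔ x ∈ s ∨ x = z := by
  obtain ⟨z, -, rfl⟩ := Finset.exists_eq_insert_iff.2 ⟨h, hc⟩
  exact ⟨z, fun x => by rw [Finset.mem_insert, or_comm]⟩

/-! ### Identification of the extremal graphs. -/

namespace IsBlockDecomposition

variable {V : Type w} [Fintype V] [DecidableEq V] {ι : Type*} [Fintype ι]
  {G : SimpleGraph V} {B : ι → SimpleGraph V} {S : ι → Finset V}

/-- In a ring of at least three blocks, two blocks have at most one vertex in common. -/
theorem eq_of_two_mem (D : IsBlockDecomposition G B S) (hG : IsTwoConnected G)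
    (hmult : ∀ x, mult S x ≤ 2) (hsh : ∀ i, (shared S i).card = 2) (hk : 3 ≤ Fintype.card ι)
    {i j : ι} {a b : V} (hab : a ≠ b) (hai : a ∈ S i) (hbi : b ∈ S i) (haj : a ∈ S j)
    (hbj : b ∈ S j) : i = j := by
  by_contra hij
  have ha := two_le_mult hij hai haj
  have hb := two_le_mult hij hbi hbj
  obtain ⟨w, c, hw, hc, hwc, hc1, hw1⟩ := D.exists_ring_numbering hG hmult hsh rfl
    (Finset.mem_filter.2 ⟨hai, ha⟩)
  obtain ⟨l, rfl⟩ := hc.2 j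
  -- With block i numbered 1 and a = w 1, the vertex b is the other shared vertex of that block;
  -- `eq_one_of_mem_cell` then applies to block j.
  have h2 : b = w (1 + 1) := by
    have := (hwc 1 b).1 (by rw [hc1]; exact Finset.mem_filter.2 ⟨hbi, hb⟩)
    rw [hw1] at this
    exact this.resolve_left hab.symm
  have h3 := (hwc l a).1 (Finset.mem_filter.2 ⟨haj, ha⟩)
  have h4 := (hwc l b).1 (Finset.mem_filter.2 ⟨hbj, hb⟩)
  rw [← hw1] at h3
  rw [h2] at h4
  have hl : l = 1 := eq_one_of_mem_cell hk
    (by simpa [cell] using h3.imp (fun h => hw h) (fun h => hw h))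
    (by rcases h4 with h | h
        · have := hw h
          simp [cell, this]
        · have := hw h
          simp [cell, this])
  exact hij (by rw [hl, hc1])

/-- Together with the last clause of `extremal` this gives n = t + 2k, where k is the number of
blocks and t = ∑ (c - 3); hence k = ⌊n/2⌋ for t = 0, 1. -/
theorem card_eq (D : IsBlockDecomposition G B S)
    (he : ∀ i, (B i).edgeSet.ncard + 3 = 2 * (S i).card) :
    G.edgeSet.ncard = 2 * ∑ i, ((S i).card - 3) + 3 * Fintype.card ι := by
  rw [← D.sum_ncard_edgeSet, Finset.mul_sum, mul_comm 3, ← smul_eq_mul, ← Finset.card_univ,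
    ← Finset.sum_const, ← Finset.sum_add_distrib]
  refine Finset.sum_congr rfl fun i _ => ?_
  have := he i
  have := D.three_le_card i
  omega

/-- A ring of triangles is isomorphic to `A_n`. -/
theorem nonempty_iso_graphA (D : IsBlockDecomposition G B S) (hG : IsTwoConnected G)
    (hmult : ∀ x, mult S x ≤ 2) (hsh : ∀ i, (shared S i).card = 2)
    (he : ∀ i, (B i).edgeSet.ncard + 3 = 2 * (S i).card) {n : ℕ} (hn : 3 ≤ n / 2)
    (hk : Fintype.card ι = n / 2) (hV : Fintype.card V = 2 * (n / 2)) (h3 : ∀ i, (S i).card = 3) :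
    Nonempty (G ≃g graphA n) := by
  have : NeZero (n / 2) := ⟨by omega⟩
  obtain ⟨i₀⟩ : Nonempty ι := Fintype.card_pos_iff.1 (by omega)
  obtain ⟨x₀, hx₀⟩ : (shared S i₀).Nonempty := Finset.card_pos.1 (by rw [hsh]; norm_num)
  obtain ⟨w, c, hw, hc, hwc, -, -⟩ := D.exists_ring_numbering hG hmult hsh hk hx₀
  -- The one unshared vertex of each triangle plays the role of u_i.
  have hz : ∀ i, ∃ z, ∀ x, x ∈ S (c i) ↔ x ∈ shared S (c i) ∨ x = z := fun i =>
    exists_mem_iff_insert (shared_subset S _) (by rw [hsh, h3])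
  choose z hz using hz
  have hmem : ∀ i x, x ∈ S (c i) ↔ ∃ a ∈ cell i, Sum.elim w z a = x := by
    intro i x
    rw [hz, hwc]
    simp [cell, eq_comm, or_assoc]
  have hsurj : Function.Surjective (Sum.elim w z) := by
    intro x
    obtain ⟨i, hi⟩ := D.exists_mem hG x
    obtain ⟨i, rfl⟩ := hc.2 i
    obtain ⟨a, -, rfl⟩ := (hmem i x).1 hi
    exact ⟨a, rfl⟩
  -- Injectivity comes from comparing cardinalities, which spares a proof that the unshared vertices
  -- are distinct.
  have hbij := (Fintype.bijective_iff_surjective_and_card (Sum.elim w z)).2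
    ⟨hsurj, by rw [hV, Fintype.card_sum, ZMod.card]; ring⟩
  have hmem' : ∀ i a, Sum.elim w z a ∈ S (c i) ↔ a ∈ cell i := by
    intro i a
    rw [hmem]
    constructor
    · rintro ⟨b, hb, h⟩
      exact hbij.1 h ▸ hb
    · exact fun h => ⟨a, h, rfl⟩
  refine ⟨(SimpleGraph.Iso.symm ⟨Equiv.ofBijective _ hbij, ?_⟩)⟩
  intro a b
  rw [graphA_adj (by omega), Equiv.ofBijective_apply, Equiv.ofBijective_apply]
  constructor
  · intro h
    obtain ⟨i, hi⟩ := D.exists_adj h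
    obtain ⟨i, rfl⟩ := hc.2 i
    exact ⟨fun hab => h.ne (hab ▸ rfl), i, (hmem' i a).1 (D.mem_left hi),
      (hmem' i b).1 (D.mem_right hi)⟩
  · rintro ⟨hab, i, ha, hb⟩
    refine D.adj (adj_of_ncard_eq_choose (fun _ _ => D.mem_left) ?_ ((hmem' i a).2 ha)
      ((hmem' i b).2 hb) (fun h => hab (hbij.1 h)))
    have := he (c i)
    rw [h3] at this ⊢
    simp [Nat.choose]
    omega

/-- Numbering of the vertices of a ring with one block of order four, all others being
triangles. -/
theorem exists_equiv_option (D : IsBlockDecomposition G B S) (hG : IsTwoConnected G)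
    (hmult : ∀ x, mult S x ≤ 2) (hsh : ∀ i, (shared S i).card = 2) {k : ℕ} (hk0 : 3 ≤ k)
    (hk : Fintype.card ι = k) (hV : Fintype.card V = 2 * k + 1) {i₀ : ι} (h4 : (S i₀).card = 4)
    (h3 : ∀ i, i ≠ i₀ → (S i).card = 3) {x₀ y : V} (hx₀ : x₀ ∈ shared S i₀) (hy : y ∈ S i₀)
    (hy' : y ∉ shared S i₀) :
    ∃ e : Option (ZMod k ⊕ ZMod k) ≃ V, e (some (Sum.inl 1)) = x₀ ∧ e none = y ∧
      (∀ x, x ∈ shared S i₀ ↔ x = e (some (Sum.inl 1)) ∨ x = e (some (Sum.inl (1 + 1)))) ∧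
      (∀ x, x ∈ S i₀ ↔ x = e none ∨ x = e (some (Sum.inl 1)) ∨ x = e (some (Sum.inl (1 + 1))) ∨
        x = e (some (Sum.inr 1))) ∧
      ∀ a b, (∃ i, e a ∈ S i ∧ e b ∈ S i) ↔ ∃ i, a ∈ optionCell i ∧ b ∈ optionCell i := by
  have : NeZero k := ⟨by omega⟩
  obtain ⟨w, c, hw, hc, hwc, hc1, hw1⟩ := D.exists_ring_numbering hG hmult hsh hk hx₀
  -- Block 1 has two unshared vertices: the chosen y becomes the added vertex and the other one u_1.
  have hz : ∀ i, ∃ z, ∀ x, x ∈ S (c i) ↔ x ∈ shared S (c i) ∨ x = z ∨ (i = 1 ∧ x = y) := by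
    intro i
    by_cases hi : i = 1
    · subst hi
      rw [hc1]
      obtain ⟨z, hz⟩ := exists_mem_iff_insert (Finset.insert_subset hy (shared_subset S i₀))
        (by rw [Finset.card_insert_of_notMem hy', hsh, h4])
      refine ⟨z, fun x => ?_⟩
      rw [hz, Finset.mem_insert]
      tauto
    · have hci : c i ≠ i₀ := fun h => hi (hc.1 (h.trans hc1.symm))
      obtain ⟨z, hz⟩ := exists_mem_iff_insert (shared_subset S (c i)) (by rw [hsh, h3 _ hci])
      exact ⟨z, fun x => by rw [hz]; simp [hi]⟩
  choose z hz using hz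
  let f : Option (ZMod k ⊕ ZMod k) → V := fun o => o.elim y (Sum.elim w z)
  have hmem : ∀ i x, x ∈ S (c i) ↔ ∃ a ∈ optionCell i, f a = x := by
    intro i x
    rw [hz, hwc]
    simp only [Option.exists, none_mem_optionCell, some_mem_optionCell, f, Option.elim, cell,
      Set.mem_insert_iff, Set.mem_singleton_iff, exists_eq_or_imp, exists_eq_left, Sum.elim_inl,
      Sum.elim_inr]
    rw [eq_comm (a := x), eq_comm (a := x), eq_comm (a := x), eq_comm (a := x)]
    tauto
  have hsurj : Function.Surjective f := by
    intro x
    obtain ⟨i, hi⟩ := D.exists_mem hG x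
    obtain ⟨i, rfl⟩ := hc.2 i
    obtain ⟨a, -, rfl⟩ := (hmem i x).1 hi
    exact ⟨a, rfl⟩
  have hbij := (Fintype.bijective_iff_surjective_and_card f).2
    ⟨hsurj, by rw [hV, Fintype.card_option, Fintype.card_sum, ZMod.card]; ring⟩
  have hmem' : ∀ i a, f a ∈ S (c i) ↔ a ∈ optionCell i := by
    intro i a
    rw [hmem]
    constructor
    · rintro ⟨b, hb, h⟩
      exact hbij.1 h ▸ hb
    · exact fun h => ⟨a, h, rfl⟩
  refine ⟨Equiv.ofBijective f hbij, hw1, rfl, ?_, ?_, ?_⟩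
  · intro x
    rw [← hc1]
    exact hwc 1 x
  · intro x
    rw [← hc1, hz, hwc]
    change _ ↔ x = y ∨ x = w 1 ∨ x = w (1 + 1) ∨ x = z 1
    tauto
  · intro a b
    constructor
    · rintro ⟨i, ha, hb⟩
      obtain ⟨i, rfl⟩ := hc.2 i
      exact ⟨i, (hmem' i a).1 ha, (hmem' i b).1 hb⟩
    · rintro ⟨i, ha, hb⟩
      exact ⟨c i, (hmem' i a).2 ha, (hmem' i b).2 hb⟩

/-- A ring of triangles and one block of order four with five edges is isomorphic to `F_n`, `G_n`
or `H_n`. -/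
theorem nonempty_iso_graphF_or_graphG_or_graphH (D : IsBlockDecomposition G B S)
    (hG : IsTwoConnected G) (hmult : ∀ x, mult S x ≤ 2) (hsh : ∀ i, (shared S i).card = 2)
    (he : ∀ i, (B i).edgeSet.ncard + 3 = 2 * (S i).card) {n : ℕ} (hn : 3 ≤ (n - 1) / 2)
    (hk : Fintype.card ι = (n - 1) / 2) (hV : Fintype.card V = 2 * ((n - 1) / 2) + 1) {i₀ : ι}
    (h4 : (S i₀).card = 4) (h3 : ∀ i, i ≠ i₀ → (S i).card = 3) :
    Nonempty (G ≃g graphF n) ∨ Nonempty (G ≃g graphG n) ∨ Nonempty (G ≃g graphH n) := by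
  obtain ⟨p, hp, r, hr, hpr, hnadj, hcomp⟩ := exists_missing_of_ncard_eq (fun _ _ => D.mem_left) (by
    have := he i₀
    rw [h4] at this ⊢
    simp [Nat.choose]
    omega)
  -- The pair p, r missing from the large block cannot be an edge of another block, since two blocks
  -- share at most one vertex.
  have hadj : ∀ x y, G.Adj x y ↔ x ≠ y ∧ s(x, y) ≠ s(p, r) ∧ ∃ i, x ∈ S i ∧ y ∈ S i := by
    intro x y
    constructor
    · intro h
      obtain ⟨i, hi⟩ := D.exists_adj h
      refine ⟨h.ne, fun hs => ?_, i, D.mem_left hi, D.mem_right hi⟩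
      have hadj : (B i).Adj p r := by
        rw [← SimpleGraph.mem_edgeSet, ← hs]
        exact hi
      obtain rfl := D.eq_of_two_mem hG hmult hsh (hk ▸ hn) hpr hp hr (D.mem_left hadj)
        (D.mem_right hadj)
      exact hnadj hadj
    · rintro ⟨hxy, hs, i, hx, hy⟩
      by_cases hi : i = i₀
      · subst hi
        exact D.adj (hcomp x hx y hy hxy hs)
      · refine D.adj (adj_of_ncard_eq_choose (fun _ _ => D.mem_left) ?_ hx hy hxy)
        have := he i
        rw [h3 i hi] at this ⊢
        simp [Nat.choose]
        omega
  have hiso : ∀ (e : Option (ZMod ((n - 1) / 2) ⊕ ZMod ((n - 1) / 2)) ≃ V) (p' r') (H),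
      (∀ a b, (∃ i, e a ∈ S i ∧ e b ∈ S i) ↔ ∃ i, a ∈ optionCell i ∧ b ∈ optionCell i) →
      s(e p', e r') = s(p, r) →
      (∀ a b, H.Adj a b ↔ a ≠ b ∧ s(a, b) ≠ s(p', r') ∧
        ∃ i, a ∈ optionCell i ∧ b ∈ optionCell i) → Nonempty (G ≃g H) := by
    intro e p' r' H hcell hs hH
    refine ⟨SimpleGraph.Iso.symm ⟨e, ?_⟩⟩
    intro a b
    rw [hadj, hH, hcell, ← hs, ← Sym2.map_mk, ← Sym2.map_mk,
      (Sym2.map.injective e.injective).ne_iff, e.injective.ne_iff]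
  have hn2 : 2 ≤ (n - 1) / 2 := by omega
  -- Starting the numbering at the shared vertex other than r forces r to be v_2, the end of the
  -- pair missing in G_n.
  have mixed : ∀ p r, p ∈ S i₀ → p ∉ shared S i₀ → r ∈ shared S i₀ →
      ∃ e : Option (ZMod ((n - 1) / 2) ⊕ ZMod ((n - 1) / 2)) ≃ V,
      (∀ a b, (∃ i, e a ∈ S i ∧ e b ∈ S i) ↔ ∃ i, a ∈ optionCell i ∧ b ∈ optionCell i) ∧
      e none = p ∧ e (some (Sum.inl (1 + 1))) = r := by
    intro p r hp hps hrs
    obtain ⟨x, hx, hxr⟩ := Finset.exists_mem_ne (by rw [hsh i₀]; norm_num) r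
    obtain ⟨e, he1, he0, hes, -, hcell⟩ :=
      D.exists_equiv_option hG hmult hsh hn hk hV h4 h3 hx hp hps
    refine ⟨e, hcell, he0, ?_⟩
    rcases (hes r).1 hrs with h | h
    · exact absurd (h.trans he1) hxr.symm
    · exact h.symm
  by_cases hps : p ∈ shared S i₀ <;> by_cases hrs : r ∈ shared S i₀
  · obtain ⟨y, hy, hys⟩ : ∃ y ∈ S i₀, y ∉ shared S i₀ :=
      Finset.exists_mem_notMem_of_card_lt_card (by rw [hsh, h4]; norm_num)
    obtain ⟨e, he1, he0, hes, -, hcell⟩ :=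
      D.exists_equiv_option hG hmult hsh hn hk hV h4 h3 hps hy hys
    refine Or.inr (Or.inr (hiso e _ _ _ hcell ?_ (graphH_adj hn2)))
    rcases (hes r).1 hrs with h | h
    · exact absurd (h.trans he1) hpr.symm
    · rw [he1, h]
  · obtain ⟨e, hcell, he0, he2⟩ := mixed r p hr hrs hps
    exact Or.inr (Or.inl (hiso e _ _ _ hcell (by rw [he0, he2, Sym2.eq_swap]) (graphG_adj hn2)))
  · obtain ⟨e, hcell, he0, he2⟩ := mixed p r hp hps hrs
    exact Or.inr (Or.inl (hiso e _ _ _ hcell (by rw [he0, he2]) (graphG_adj hn2)))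
  · obtain ⟨x, hx⟩ : (shared S i₀).Nonempty := Finset.card_pos.1 (by rw [hsh]; norm_num)
    obtain ⟨e, he1, he0, hes, heS, hcell⟩ :=
      D.exists_equiv_option hG hmult hsh hn hk hV h4 h3 hx hp hps
    refine Or.inl (hiso e _ _ _ hcell ?_ (graphF_adj hn2))
    have hr' : ¬ (r = e (some (Sum.inl 1)) ∨ r = e (some (Sum.inl (1 + 1)))) := fun h =>
      hrs ((hes r).2 h)
    rcases (heS r).1 hr with h | h | h | h
    · exact absurd (h.trans he0) hpr.symm
    · exact absurd (Or.inl h) hr'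
    · exact absurd (Or.inr h) hr'
    · rw [he0, h]

end IsBlockDecomposition

/-! ### Arithmetic of the bound and the conclusion. -/

theorem ceil_three_mul_div_two (n : ℕ) : ⌈(3 * n : ℚ) / 2⌉₊ = (3 * n + 1) / 2 := by
  obtain ⟨m, rfl | rfl⟩ := Nat.even_or_odd' n
  · have h : (3 * (2 * m : ℕ) : ℚ) / 2 = (3 * m : ℕ) := by push_cast; ring
    rw [h, Nat.ceil_natCast]
    omega
  · rw [Nat.ceil_eq_iff (by omega), show (3 * (2 * m + 1) + 1) / 2 = 3 * m + 2 by omega]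
    push_cast
    constructor <;> linarith

theorem exists_of_sum_eq_one {ι : Type*} [Fintype ι] {f : ι → ℕ} (h : ∑ i, f i = 1) :
    ∃ i₀, f i₀ = 1 ∧ ∀ i, i ≠ i₀ → f i = 0 := by
  classical
  obtain ⟨i₀, -, hi₀⟩ := Finset.exists_ne_zero_of_sum_ne_zero (h.trans_ne one_ne_zero)
  have h1 := Finset.add_sum_erase Finset.univ f (Finset.mem_univ i₀)
  have h2 : ∑ i ∈ Finset.univ.erase i₀, f i = 0 := by omega
  exact ⟨i₀, by omega, fun i hi => Finset.sum_eq_zero_iff.1 h2 i (by simpa using hi)⟩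

end TriangleRing

theorem lemma1 {V : Type*} [Fintype V] [DecidableEq V] (G : SimpleGraph V) [DecidableRel G.Adj]
    (n : ℕ) (hcard : Fintype.card V = n) (hn : 6 ≤ n) :
    (TriangleRing.IsTwoConnected G ∧ TriangleRing.EveryEdgeInTriangle G →
      ⌈(3 * n : ℚ) / 2⌉₊ ≤ G.edgeFinset.card) ∧
    (8 ≤ n → Even n →
      (TriangleRing.IsTwoConnected G ∧ TriangleRing.EveryEdgeInTriangle G ∧
          G.edgeFinset.card = ⌈(3 * n : ℚ) / 2⌉₊ ↔
        Nonempty (G ≃g TriangleRing.graphA n))) ∧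
    (9 ≤ n → Odd n →
      (TriangleRing.IsTwoConnected G ∧ TriangleRing.EveryEdgeInTriangle G ∧
          G.edgeFinset.card = ⌈(3 * n : ℚ) / 2⌉₊ ↔
        Nonempty (G ≃g TriangleRing.graphF n) ∨ Nonempty (G ≃g TriangleRing.graphG n) ∨
          Nonempty (G ≃g TriangleRing.graphH n))) := by
  open TriangleRing in
  have hm : G.edgeFinset.card = G.edgeSet.ncard := by
    rw [← SimpleGraph.coe_edgeFinset, Set.ncard_coe_finset]
  rw [hm, ceil_three_mul_div_two]
  subst hcard
  refine ⟨?_, ?_, ?_⟩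
  · rintro ⟨hG, htri⟩
    obtain ⟨ι, _, B, S, D⟩ := exists_isBlockDecomposition htri
    have := D.three_mul_card_le hG hn
    omega
  · rintro h8 heven
    have heven := Nat.even_iff.1 heven
    constructor
    · rintro ⟨hG, htri, hm⟩
      obtain ⟨ι, _, B, S, D⟩ := exists_isBlockDecomposition htri
      obtain ⟨hmult, hsh, he, hsum⟩ := D.extremal hG h8 (by omega)
      have hcard := D.card_eq he
      have h0 : ∑ i, ((S i).card - 3) = 0 := by omega
      refine D.nonempty_iso_graphA hG hmult hsh he (by omega) (by omega) (by omega) fun i => ?_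
      have h1 := Finset.sum_eq_zero_iff.1 h0 i (Finset.mem_univ i)
      have := D.three_le_card i
      omega
    · rintro ⟨e⟩
      obtain ⟨h1, h2, h3⟩ := isTwoConnected_and_ncard_of_iso e (by omega)
        (noCut_graphA (by omega)) (everyEdgeInTriangle_graphA (by omega))
      refine ⟨h1, h2, ?_⟩
      rw [h3, ncard_edgeSet_graphA (by omega)]
      omega
  · rintro h9 hodd
    have hodd := Nat.odd_iff.1 hodd
    constructor
    · rintro ⟨hG, htri, hm⟩
      obtain ⟨ι, _, B, S, D⟩ := exists_isBlockDecomposition htri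
      obtain ⟨hmult, hsh, he, hsum⟩ := D.extremal hG (by omega) (by omega)
      have hcard := D.card_eq he
      have h0 : ∑ i, ((S i).card - 3) = 1 := by omega
      obtain ⟨i₀, h4, h3⟩ := exists_of_sum_eq_one h0
      refine D.nonempty_iso_graphF_or_graphG_or_graphH hG hmult hsh he (by omega) (by omega)
        (by omega) (i₀ := i₀) (by omega) fun i hi => ?_
      have h1 := h3 i hi
      have := D.three_le_card i
      omega
    · have h3V : 3 ≤ Fintype.card V := by omega
      have hq : 3 ≤ (Fintype.card V - 1) / 2 := by omega
      have hq2 : 2 ≤ (Fintype.card V - 1) / 2 := by omega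
      rintro (⟨⟨e⟩⟩ | ⟨⟨e⟩⟩ | ⟨⟨e⟩⟩)
      · obtain ⟨h1, h2, h3⟩ := isTwoConnected_and_ncard_of_iso e h3V (noCut_graphF hq2)
          (everyEdgeInTriangle_graphF hq2)
        refine ⟨h1, h2, ?_⟩
        rw [h3, ncard_edgeSet_graphF hq]
        omega
      · obtain ⟨h1, h2, h3⟩ := isTwoConnected_and_ncard_of_iso e h3V (noCut_graphG hq2)
          (everyEdgeInTriangle_graphG hq2)
        refine ⟨h1, h2, ?_⟩
        rw [h3, ncard_edgeSet_graphG hq]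
        omega
      · obtain ⟨h1, h2, h3⟩ := isTwoConnected_and_ncard_of_iso e h3V (noCut_graphH hq2)
          (everyEdgeInTriangle_graphH hq)
        refine ⟨h1, h2, ?_⟩
        rw [h3, ncard_edgeSet_graphH hq]
        omega
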